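/- Let $(M^5,g)$ be a smooth Riemannian manifold of dimension $5$ with an almost contact metric structure: a smooth vector field $\xi$ of length one, its dual $1$-form $\eta=g(\xi,\cdot)$ and a smooth endomorphism $\varphi$ of $TM$ with $\varphi(\xi)=0$, $\varphi^2=-\mathrm{Id}+\eta\otimes\xi$ and $g(\varphi X,\varphi Y)=g(X,Y)-\eta(X)\eta(Y)$. Let $\Phi(X,Y)=g(X,\varphi Y)$ be the fundamental form, and let $$N(X,Y,Z)=g\big(X,[\varphi,\varphi](Y,Z)\big)+\eta(X)\,d\eta(Y,Z),$$ $$[\varphi,\varphi](Y,Z)=[\varphi Y,\varphi Z]+\varphi^2[Y,Z]-\varphi[\varphi Y,Z]-\varphi[Y,\varphi Z],$$ be the Nijenhuis tensor, where $d\eta(Y,Z)=Y\eta(Z)-Z\eta(Y)-\eta([Y,Z])$. The structure is called quasi-Sasaki if $N=0$ and $d\Phi=0$. It is called generalized quasi-Sasaki if $N(X,Y,Z)=0$ and $d\Phi(X,Y,Z)=0$ for all $X,Y,Z$ orthogonal to $\xi$, and $\xi$ is a Killing vector field. An adapted frame is a smooth local orthonormal frame $(e_1,\dots,e_5)$ with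 $\Phi=e_1\wedge e_2+e_3\wedge e_4$ and $\eta=e_5$ (vectors and covectors are identified by $g$); such frames exist around every point. Let $\nabla^g$ be the Levi-Civita connection and $\Omega(X)=\big(g(\nabla^g_Xe_i,e_j)\big)_{i,j}\in\mathfrak{so}(5)=\Lambda^2$ its connection form with respect to an adapted frame. The intrinsic torsion is $\Gamma(X)=\mathrm{pr}_{\mathfrak{u}(2)^\perp}(\Omega(X))$, where $\mathfrak{u}(2)\subset\mathfrak{so}(5)$ is the Lie algebra of the stabilizer $U(2)$ of $(\Phi,\eta)$ and the projection is orthogonal with respect to $\langle x,y\rangle=-\tfrac12\mathrm{tr}(x\circ y)$. Thus $\Gamma$ takes values in the $U(2)$-module $\mathcal W=\Lambda^1\otimes\mathfrak{u}(2)^\perp$. Let $*$ be the Hodge operator for the orientation $e_1\wedge\dots\wedge e_5$, and put $$\Lambda^2_1=\mathbb R\,\Phi,\quad \Lambda^2_2=\{\beta\in\Lambda^2 : \Phi\wedge\beta=0,\ *\beta=\eta\wedge\beta\},\quad \Lambda^2_3=\{\beta\in\Lambda^2 : *\beta=-\eta\wedge\beta\}.$$ For $\beta\in\Lambda^2$ define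 $\theta(\beta),\vartheta(\beta)\in\Lambda^1\otimes\Lambda^2$ by $\theta(\beta)(X,Y,Z)=*\beta(X,Y,Z)$ and $\vartheta(\beta)(X,Y,Z)=3\,\eta(X)\beta(Y,Z)-*\beta(X,Y,Z)$, let $\mathrm{pr}_{\mathcal W}(\alpha\otimes\beta)=\alpha\otimes\mathrm{pr}_{\mathfrak{u}(2)^\perp}(\beta)$, and set $$\mathcal W_3=\mathrm{pr}_{\mathcal W}(\theta(\Lambda^2_1)),\quad \mathcal W_4=\mathrm{pr}_{\mathcal W}(\theta(\Lambda^2_2)),\quad \mathcal W_5=\mathrm{pr}_{\mathcal W}(\theta(\Lambda^2_3)),\quad \mathcal W_7=\mathrm{pr}_{\mathcal W}(\vartheta(\Lambda^2_2)).$$ Then the structure is generalized quasi-Sasaki if and only if $\Gamma\in\mathcal W_3\oplus\mathcal W_4\oplus\mathcal W_5\oplus\mathcal W_7$ at every point, and it is quasi-Sasaki if and only if $\Gamma\in\mathcal W_3\oplus\mathcal W_5$ at every point. -/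

import Mathlib

open Bundle
open scoped Manifold ContDiff

noncomputable section

namespace ACM

/-! ## Linear algebra of the model space `ℝ⁵ = ℝ⁴ ⊕ ℝ η`

Two-forms on `ℝ⁵` (equivalently elements of `so(5)`) are given by their skew-symmetric matrices of
components `β i j = β(e_i, e_j)`, elements of `Λ¹ ⊗ Λ²` by their components
`a k i j = a(e_k, e_i, e_j)`, where `e_0, …, e_4` is the standard basis. -/

/-- `5 × 5` matrices. -/
abbrev Mat := Matrix (Fin 5) (Fin 5) ℝ

/-- Components of `(3,0)`-tensors. -/
abbrev Ten3 := Fin 5 → Mat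

/-- Components of `(4,0)`-tensors. -/
abbrev Ten4 := Fin 5 → Fin 5 → Mat

/-- `Λ² = so(5)`. -/
def so5 : Submodule ℝ Mat where
  carrier := {A | A.transpose = -A}
  zero_mem' := by simp
  add_mem' {A B} hA hB := by
    simp only [Set.mem_ofPred_eq] at hA hB ⊢
    rw [Matrix.transpose_add, hA, hB]; abel
  smul_mem' c A hA := by
    simp only [Set.mem_ofPred_eq] at hA ⊢
    rw [Matrix.transpose_smul, hA, smul_neg]

/-- The scalar product `-(1/2) tr(x ∘ y)` on `so(5)`. -/
def innerSo (A B : Mat) : ℝ := -(1 / 2) * (A * B).trace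

/-- The standard fundamental form `e_0 ∧ e_1 + e_2 ∧ e_3`. As `Φ(X, Y) = g(X, φ Y)`, this is also
the matrix of the standard endomorphism `φ`. -/
def Phi0 : Mat :=
  !![0, 1, 0, 0, 0;
     -1, 0, 0, 0, 0;
     0, 0, 0, 1, 0;
     0, 0, -1, 0, 0;
     0, 0, 0, 0, 0]

/-- The standard form `η = e_4`. -/
def eta0 : Fin 5 → ℝ := Pi.single 4 1

/-- `u(2)`, the Lie algebra of the stabilizer `U(2)` of the standard structure: the skew-symmetric
matrices that commute with `φ`. (These also annihilate `e_4`, which spans the kernel of `φ`.) -/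
def u2 : Submodule ℝ Mat where
  carrier := {A | A ∈ so5 ∧ A * Phi0 = Phi0 * A}
  zero_mem' := ⟨so5.zero_mem, by simp⟩
  add_mem' hA hB := ⟨so5.add_mem hA.1 hB.1, by rw [add_mul, mul_add, hA.2, hB.2]⟩
  smul_mem' c A hA := ⟨so5.smul_mem c hA.1, by rw [smul_mul_assoc, mul_smul_comm, hA.2]⟩

/-- `u(2)^⊥`, the orthogonal complement of `u(2)` inside `so(5)`. -/
def u2Perp : Submodule ℝ Mat where
  carrier := {A | A ∈ so5 ∧ ∀ B ∈ u2, innerSo A B = 0}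
  zero_mem' := ⟨so5.zero_mem, fun B _ => by simp [innerSo]⟩
  add_mem' {A A'} hA hA' := ⟨so5.add_mem hA.1 hA'.1, fun B hB => by
    have h1 := hA.2 B hB
    have h2 := hA'.2 B hB
    simp only [innerSo] at h1 h2 ⊢
    rw [add_mul, Matrix.trace_add]; linarith⟩
  smul_mem' c A hA := ⟨so5.smul_mem c hA.1, fun B hB => by
    have h1 := hA.2 B hB
    simp only [innerSo] at h1 ⊢
    rw [smul_mul_assoc, Matrix.trace_smul, smul_eq_mul]; linear_combination c * h1⟩

/-- The orthogonal projection of `so(5)` onto `u(2)^⊥`, by an explicit formula;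
see `prPerp_spec`. -/
def prPerp : Mat →ₗ[ℝ] Mat where
  toFun A := A - (1 / 2 : ℝ) • (Phi0 * Phi0 * A * (Phi0 * Phi0) - Phi0 * A * Phi0)
  map_add' A B := by simp only [mul_add, add_mul]; module
  map_smul' c A := by
    simp only [mul_smul_comm, smul_mul_assoc, RingHom.id_apply]; module

lemma Phi0_cube : Phi0 * Phi0 * Phi0 = -Phi0 := by
  ext i j
  fin_cases i <;> fin_cases j <;> simp [Phi0, Matrix.mul_apply, Fin.sum_univ_five]

lemma Phi0_transpose : Phi0.transpose = -Phi0 := by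
  ext i j
  fin_cases i <;> fin_cases j <;> simp [Phi0]

lemma Phi0_mem : Phi0 ∈ so5 := Phi0_transpose

/-- `prPerp` is the orthogonal projection of `so(5)` onto `u(2)^⊥`. -/
theorem prPerp_spec {A : Mat} (hA : A ∈ so5) : prPerp A ∈ u2Perp ∧ A - prPerp A ∈ u2 := by
  have hA' : A.transpose = -A := hA
  have h3 : Phi0 * (Phi0 * Phi0) = -Phi0 := by rw [← mul_assoc, Phi0_cube]
  have hd : A - prPerp A
      = (1 / 2 : ℝ) • (Phi0 * Phi0 * A * (Phi0 * Phi0) - Phi0 * A * Phi0) := by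
    simp [prPerp]
  have hmem : A - prPerp A ∈ u2 := by
    rw [hd]
    refine u2.smul_mem _ ⟨?_, ?_⟩
    · change Matrix.transpose _ = _
      simp only [Matrix.transpose_sub, Matrix.transpose_mul, Phi0_transpose, hA']
      noncomm_ring
    · have e1 : Phi0 * Phi0 * A * (Phi0 * Phi0) * Phi0 = -(Phi0 * Phi0 * A * Phi0) := by
        rw [mul_assoc _ (Phi0 * Phi0) Phi0, Phi0_cube, mul_neg]
      have e2 : Phi0 * (Phi0 * Phi0 * A * (Phi0 * Phi0)) = -(Phi0 * A * (Phi0 * Phi0)) := by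
        simp only [← mul_assoc]
        rw [Phi0_cube]
        simp only [neg_mul]
      rw [sub_mul, mul_sub, e1, e2]
      noncomm_ring
  refine ⟨⟨?_, ?_⟩, hmem⟩
  · have := so5.sub_mem hA hmem.1
    rwa [sub_sub_cancel] at this
  · rintro B ⟨hB, hc⟩
    have hB' : ∀ i j, B j i = -B i j := fun i j => congrFun (congrFun hB i) j
    have hcc : ∀ j, (B * Phi0) 4 j = (Phi0 * B) 4 j := fun j => by rw [hc]
    have hz : ∀ j, B 4 j = 0 := by
      intro j
      have c0 := hcc 0
      have c1 := hcc 1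
      have c2 := hcc 2
      have c3 := hcc 3
      have c4 := hB' 4 4
      simp [Phi0, Matrix.mul_apply, Fin.sum_univ_five] at c0 c1 c2 c3
      fin_cases j <;> simp only [Fin.reduceFinMk, Fin.zero_eta, Fin.mk_one, Fin.isValue] <;>
        linarith
    have hpp : Phi0 * Phi0 * B = -B := by
      ext i j
      have := hz j
      fin_cases i <;> simp [Phi0, Matrix.mul_apply, Fin.sum_univ_five, this]
    have q1 : (Phi0 * Phi0 * A * (Phi0 * Phi0) * B).trace = (A * B).trace := by
      rw [mul_assoc _ (Phi0 * Phi0) B, hpp, mul_assoc, Matrix.trace_mul_comm, mul_assoc]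
      congr 2
      rw [neg_mul, ← mul_assoc, hc, mul_assoc, hc, ← mul_assoc, hpp, neg_neg]
    have q2 : (Phi0 * A * Phi0 * B).trace = -(A * B).trace := by
      rw [mul_assoc, mul_assoc, Matrix.trace_mul_comm, mul_assoc, mul_assoc, hc, ← mul_assoc Phi0,
        hpp, mul_neg, Matrix.trace_neg]
    simp only [innerSo, prPerp, LinearMap.coe_mk, AddHom.coe_mk, sub_mul, smul_mul_assoc,
      Matrix.trace_sub, Matrix.trace_smul, q1, q2, smul_eq_mul]
    ring

/-- The Levi-Civita symbol: the sign of `p` if `p` is a permutation, and `0` otherwise. -/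
def eps (p : Fin 5 → Fin 5) : ℤ :=
  ∏ i, ∏ j ∈ Finset.Ioi i, (if p i < p j then 1 else if p j < p i then -1 else 0)

/-- The Hodge operator from two-forms to three-forms, for the orientation `e_0 ∧ … ∧ e_4`. -/
def hodge : Mat →ₗ[ℝ] Ten3 where
  toFun β := fun i => Matrix.of fun j k =>
    (1 / 2 : ℝ) * ∑ l, ∑ m, (eps ![l, m, i, j, k] : ℝ) * β l m
  map_add' β γ := by
    ext i j k
    simp only [Matrix.add_apply, Pi.add_apply, Matrix.of_apply, mul_add, Finset.sum_add_distrib]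
  map_smul' c β := by
    ext i j k
    simp only [Matrix.smul_apply, Pi.smul_apply, Matrix.of_apply, smul_eq_mul, RingHom.id_apply,
      Finset.mul_sum]
    exact Finset.sum_congr rfl fun l _ => Finset.sum_congr rfl fun m _ => by ring

/-- `β ↦ η ∧ β` on two-forms. -/
def etaWedge : Mat →ₗ[ℝ] Ten3 where
  toFun β := fun i => Matrix.of fun j k => eta0 i * β j k + eta0 j * β k i + eta0 k * β i j
  map_add' β γ := by
    ext i j k; simp only [Matrix.add_apply, Pi.add_apply, Matrix.of_apply]; ring
  map_smul' c β := by
    ext i j k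
    simp only [Matrix.smul_apply, Pi.smul_apply, Matrix.of_apply, smul_eq_mul, RingHom.id_apply]
    ring

/-- `β ↦ Φ ∧ β` on two-forms. -/
def phiWedge : Mat →ₗ[ℝ] Ten4 where
  toFun β := fun i j => Matrix.of fun k l =>
    Phi0 i j * β k l - Phi0 i k * β j l + Phi0 i l * β j k
      + Phi0 j k * β i l - Phi0 j l * β i k + Phi0 k l * β i j
  map_add' β γ := by
    ext i j k l; simp only [Matrix.add_apply, Pi.add_apply, Matrix.of_apply]; ring
  map_smul' c β := by
    ext i j k l
    simp only [Matrix.smul_apply, Pi.smul_apply, Matrix.of_apply, smul_eq_mul, RingHom.id_apply]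
    ring

/-- `Λ²_1 = ℝ Φ`. -/
def L1 : Submodule ℝ Mat := Submodule.span ℝ {Phi0}

/-- `Λ²_2 = {β ∈ Λ² | Φ ∧ β = 0, *β = η ∧ β}`. -/
def L2 : Submodule ℝ Mat := so5 ⊓ LinearMap.ker phiWedge ⊓ LinearMap.eqLocus hodge etaWedge

/-- `Λ²_3 = {β ∈ Λ² | *β = - η ∧ β}`. -/
def L3 : Submodule ℝ Mat := so5 ⊓ LinearMap.eqLocus hodge (-etaWedge)

/-- `θ(β)(X, Y, Z) = *β(X, Y, Z)`. -/
def theta : Mat →ₗ[ℝ] Ten3 := hodge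

/-- `β ↦ η ⊗ β`. -/
def etaTensor : Mat →ₗ[ℝ] Ten3 := LinearMap.pi fun i => eta0 i • LinearMap.id

/-- `ϑ(β)(X, Y, Z) = 3 η(X) β(Y, Z) - *β(X, Y, Z)`. -/
def vartheta : Mat →ₗ[ℝ] Ten3 := (3 : ℝ) • etaTensor - hodge

/-- `pr_W : Λ¹ ⊗ Λ² → W = Λ¹ ⊗ u(2)^⊥`, `α ⊗ β ↦ α ⊗ pr(β)`. -/
def prW : Ten3 →ₗ[ℝ] Ten3 := LinearMap.pi fun k => prPerp ∘ₗ LinearMap.proj k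

/-- `W₃ = pr_W(θ(Λ²_1))`. -/
def W3 : Submodule ℝ Ten3 := L1.map (prW ∘ₗ theta)

/-- `W₄ = pr_W(θ(Λ²_2))`. -/
def W4 : Submodule ℝ Ten3 := L2.map (prW ∘ₗ theta)

/-- `W₅ = pr_W(θ(Λ²_3))`. -/
def W5 : Submodule ℝ Ten3 := L3.map (prW ∘ₗ theta)

/-- `W₇ = pr_W(ϑ(Λ²_2))`. -/
def W7 : Submodule ℝ Ten3 := L2.map (prW ∘ₗ vartheta)

/-! ## Riemannian geometry in dimension five -/

/-- The model space. -/
abbrev E5 := EuclideanSpace ℝ (Fin 5)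

/-- Vector fields (no regularity). -/
abbrev VF (M : Type*) [TopologicalSpace M] [ChartedSpace E5 M] :=
  Π x : M, TangentSpace (𝓡 5) x

section Geometry

variable {M : Type*} [TopologicalSpace M] [ChartedSpace E5 M] [IsManifold (𝓡 5) ∞ M]

/-- The vector field `X` is smooth on the set `U`. -/
def SmoothOn (X : VF M) (U : Set M) : Prop :=
  ContMDiffOn (𝓡 5) (𝓡 5).tangent ∞ (fun y => (⟨y, X y⟩ : TangentBundle (𝓡 5) M)) U

/-- The vector field `X` is smooth at the point `x`. -/
def SmoothAt (X : VF M) (x : M) : Prop :=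
  ContMDiffAt (𝓡 5) (𝓡 5).tangent ∞ (fun y => (⟨y, X y⟩ : TangentBundle (𝓡 5) M)) x

/-- The derivative `X(f)` of a function along a vector field. -/
def der (X : VF M) (f : M → ℝ) (x : M) : ℝ := mvfderiv (𝓡 5) f x (X x)

/-- The Lie bracket `[X, Y]`. -/
def br (X Y : VF M) : VF M := VectorField.mlieBracket (𝓡 5) X Y

variable [RiemannianBundle (fun x : M => TangentSpace (𝓡 5) x)]

/-- The metric `g(X, Y)`. -/
def g (X Y : VF M) (x : M) : ℝ := inner ℝ (X x) (Y x)

/-- `g(∇_X Y, Z)` for the Levi-Civita connection `∇`, by the Koszul formula;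
see `inner_eq_nablaInner`. -/
def nablaInner (X Y Z : VF M) (x : M) : ℝ :=
  (1 / 2) * (der X (g Y Z) x + der Y (g X Z) x - der Z (g X Y) x
    + g (br X Y) Z x - g (br X Z) Y x - g (br Y Z) X x)

/-- `ξ` is a Killing vector field: the Lie derivative `L_ξ g` vanishes. -/
def IsKilling (ξ : VF M) : Prop :=
  ∀ (x : M) (X Y : VF M), SmoothAt X x → SmoothAt Y x →
    der ξ (g X Y) x - g (br ξ X) Y x - g X (br ξ Y) x = 0

variable [IsContMDiffRiemannianBundle (𝓡 5) ∞ E5 (fun x : M => TangentSpace (𝓡 5) x)]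

set_option synthInstance.maxHeartbeats 200000 in
/-- `nablaInner` is `g(∇_X Y, Z)` for every metric and torsion-free connection `∇`. -/
theorem inner_eq_nablaInner
    (cov : CovariantDerivative (𝓡 5) E5 (fun x : M => TangentSpace (𝓡 5) x))
    (hmet : cov.IsMetricCompatible) (htor : cov.torsion = 0) {x : M} {X Y Z : VF M}
    (hX : SmoothAt X x) (hY : SmoothAt Y x) (hZ : SmoothAt Z x) :
    inner ℝ (cov Y x (X x)) (Z x) = nablaInner X Y Z x := by
  have hX' := hX.mdifferentiableAt (by simp)
  have hY' := hY.mdifferentiableAt (by simp)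
  have hZ' := hZ.mdifferentiableAt (by simp)
  have m1 : mvfderiv (𝓡 5) (g Y Z) x (X x)
      = inner ℝ (cov Y x (X x)) (Z x) + inner ℝ (Y x) (cov Z x (X x)) :=
    hmet.mvfderiv_inner_eq X hY' hZ'
  have m2 : mvfderiv (𝓡 5) (g X Z) x (Y x)
      = inner ℝ (cov X x (Y x)) (Z x) + inner ℝ (X x) (cov Z x (Y x)) :=
    hmet.mvfderiv_inner_eq Y hX' hZ'
  have m3 : mvfderiv (𝓡 5) (g X Y) x (Z x)
      = inner ℝ (cov X x (Z x)) (Y x) + inner ℝ (X x) (cov Y x (Z x)) :=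
    hmet.mvfderiv_inner_eq Z hX' hY'
  have t1 := (CovariantDerivative.torsion_eq_zero_iff (cov := cov)).1 htor hX' hY'
  have t2 := (CovariantDerivative.torsion_eq_zero_iff (cov := cov)).1 htor hX' hZ'
  have t3 := (CovariantDerivative.torsion_eq_zero_iff (cov := cov)).1 htor hY' hZ'
  simp only [nablaInner, der]
  rw [m1, m2, m3]
  simp only [g, br]
  rw [← t1, ← t2, ← t3]
  simp only [inner_sub_left]
  rw [real_inner_comm (cov Z x (X x)), real_inner_comm (cov Z x (Y x)),
    real_inner_comm (cov Y x (Z x))]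
  ring

end Geometry

/-! ## Almost contact metric structures -/

/-- An almost contact metric structure on a Riemannian 5-manifold: a smooth vector field `ξ` of
length one, with dual one-form `η = g(ξ, ·)`, and a smooth endomorphism `φ` of the tangent
bundle. -/
structure AlmostContact (M : Type*) [TopologicalSpace M] [ChartedSpace E5 M]
    [IsManifold (𝓡 5) ∞ M] [RiemannianBundle (fun x : M => TangentSpace (𝓡 5) x)] where
  /-- the vector field -/
  ξ : Π x : M, TangentSpace (𝓡 5) x
  /-- the endomorphism -/
  φ : Π x : M, TangentSpace (𝓡 5) x →L[ℝ] TangentSpace (𝓡 5) x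
  smooth_ξ : ContMDiff (𝓡 5) (𝓡 5).tangent ∞ (fun x => (⟨x, ξ x⟩ : TangentBundle (𝓡 5) M))
  smooth_φ : ContMDiff (𝓡 5) ((𝓡 5).prod 𝓘(ℝ, E5 →L[ℝ] E5)) ∞
    (fun x => TotalSpace.mk' (E5 →L[ℝ] E5)
      (E := fun x : M => TangentSpace (𝓡 5) x →L[ℝ] TangentSpace (𝓡 5) x) x (φ x))
  norm_ξ : ∀ x, inner ℝ (ξ x) (ξ x) = (1 : ℝ)
  φ_ξ : ∀ x, φ x (ξ x) = 0
  φ_sq : ∀ (x : M) (v : TangentSpace (𝓡 5) x),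
    φ x (φ x v) = -v + (inner ℝ (ξ x) v : ℝ) • ξ x
  inner_φ : ∀ (x : M) (v w : TangentSpace (𝓡 5) x),
    inner ℝ (φ x v) (φ x w) = (inner ℝ v w - inner ℝ (ξ x) v * inner ℝ (ξ x) w : ℝ)

namespace AlmostContact

variable {M : Type*} [TopologicalSpace M] [ChartedSpace E5 M] [IsManifold (𝓡 5) ∞ M]
  [RiemannianBundle (fun x : M => TangentSpace (𝓡 5) x)] (S : AlmostContact M)

/-- The one-form `η`, evaluated on vector fields. -/
def eta (X : VF M) (x : M) : ℝ := inner ℝ (S.ξ x) (X x)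

/-- The vector field `φ(X)`. -/
def ap (X : VF M) : VF M := fun x => S.φ x (X x)

/-- The fundamental form `Φ(X, Y) = g(X, φ(Y))`. -/
def Phi (X Y : VF M) (x : M) : ℝ := g X (S.ap Y) x

/-- The exterior derivative `dη`. -/
def dEta (X Y : VF M) (x : M) : ℝ :=
  der X (S.eta Y) x - der Y (S.eta X) x - S.eta (br X Y) x

/-- The exterior derivative `dΦ`. -/
def dPhi (X Y Z : VF M) (x : M) : ℝ :=
  der X (S.Phi Y Z) x - der Y (S.Phi X Z) x + der Z (S.Phi X Y) x
    - S.Phi (br X Y) Z x + S.Phi (br X Z) Y x - S.Phi (br Y Z) X x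

/-- The Nijenhuis torsion `[φ, φ](X, Y)` of `φ`. -/
def nijTorsion (X Y : VF M) : VF M :=
  br (S.ap X) (S.ap Y) + S.ap (S.ap (br X Y)) - S.ap (br (S.ap X) Y) - S.ap (br X (S.ap Y))

/-- The Nijenhuis tensor `N(X, Y, Z) = g(X, [φ, φ](Y, Z)) + η(X) dη(Y, Z)`. -/
def nijenhuis (X Y Z : VF M) (x : M) : ℝ :=
  g X (S.nijTorsion Y Z) x + S.eta X x * S.dEta Y Z x

/-- Quasi-Sasaki: `N = 0` and `dΦ = 0`. -/
def IsQuasiSasaki : Prop :=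
  ∀ (x : M) (X Y Z : VF M), SmoothAt X x → SmoothAt Y x → SmoothAt Z x →
    S.nijenhuis X Y Z x = 0 ∧ S.dPhi X Y Z x = 0

/-- Generalized quasi-Sasaki: the tensors `N` and `dΦ` vanish on vectors orthogonal to `ξ`, and `ξ`
is a Killing vector field. -/
def IsGenQuasiSasaki : Prop :=
  (∀ (x : M) (X Y Z : VF M), SmoothAt X x → SmoothAt Y x → SmoothAt Z x →
    S.eta X x = 0 → S.eta Y x = 0 → S.eta Z x = 0 →
    S.nijenhuis X Y Z x = 0 ∧ S.dPhi X Y Z x = 0) ∧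
  IsKilling S.ξ

/-- `e` is a smooth adapted frame on the open set `U`: it is orthonormal, `Φ = e₀ ∧ e₁ + e₂ ∧ e₃`
and `e₄` is dual to `η`. -/
structure IsAdaptedFrame (e : Fin 5 → VF M) (U : Set M) : Prop where
  isOpen : IsOpen U
  smooth : ∀ i, SmoothOn (e i) U
  orthonormal : ∀ x ∈ U, Orthonormal ℝ (fun i => e i x)
  phi : ∀ x ∈ U, ∀ i j, S.Phi (e i) (e j) x = Phi0 i j
  xi : ∀ x ∈ U, e 4 x = S.ξ x

/-- The components `Ω(e_k)_{ij} = ω_{ij}(e_k) = g(∇_{e_k} e_i, e_j)` at `x` of the connection form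
of the Levi-Civita connection with respect to the frame `e`. -/
def connForm (e : Fin 5 → VF M) (x : M) : Ten3 :=
  fun k => Matrix.of fun i j => nablaInner (e k) (e i) (e j) x

/-- The components at `x` of the intrinsic torsion `Γ(X) = pr(Ω(X))`, with respect to the adapted
frame `e`. -/
def intrinsicTorsion (e : Fin 5 → VF M) (x : M) : Ten3 := fun k => prPerp (connForm e x k)

/-- The structure is of class `W`, for a `U(2)`-submodule `W` of `Λ¹ ⊗ u(2)^⊥`: at each point `x`,
the components of the intrinsic torsion with respect to the adapted frames around `x` lie in `W`.
(There are such frames around each point; the first clause only makes this visible.) -/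
def IsOfClass (W : Submodule ℝ Ten3) : Prop :=
  ∀ x : M, (∃ (e : Fin 5 → VF M) (U : Set M), S.IsAdaptedFrame e U ∧ x ∈ U) ∧
    ∀ (e : Fin 5 → VF M) (U : Set M), S.IsAdaptedFrame e U → x ∈ U → intrinsicTorsion e x ∈ W

end AlmostContact

end ACM

end

/-!
Fix an adapted frame `e_0, …, e_4` near a point and let `w k i j = g(∇_{e_k} e_i, e_j)`. Since the
Levi-Civita connection is metric and torsion-free, `w` is skew in its last two indices and the
structure constants are `g([e_i, e_j], e_k) = w i j k - w j i k`. In the frame `φ` has constant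
coefficients, so `N`, `dΦ` and `L_ξ g` are linear in the structure constants, hence in `w`; and as
all three are tensorial, their vanishing has to be checked on the frame only. Adapted frames exist
around each point by a Gram–Schmidt argument (`exists_isAdaptedFrame`).

What remains is linear algebra in `w`. Write `A(e_k, e_i) = w k 4 i` for the components of `∇ξ`, and
note that `u(2)^⊥ = Λ²_2 ⊕ η ∧ ℝ⁴`, so that `Γ` consists of `A` and of the `Λ²_2`-parts of
the `w k`.

* `Λ²_2` and `Λ²_3` consist of horizontal forms, on which `*β = ± η ∧ β`. So `θ(β)` contributes
  `∓ β` to `A`, and only for `β ∈ Λ²_2` a multiple of `η ⊗ β` to the rest; `ϑ(β)` does so with a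
  different ratio. Therefore `W₃ ⊕ W₄ ⊕ W₅ ⊕ W₇` is given by the equations: `A` is skew, and `w k`
  has no `Λ²_2`-part for `k ≠ 4` (`prW_mem_sup_iff`). For `W₃ ⊕ W₅` the `Λ²_2`-parts of `A` and of `w 4`
  vanish as well (`prW_mem_W3_sup_W5_iff`).
* `A` is skew if and only if `ξ` is a Killing field. That a skew form has no `Λ²_2`-part means that
  its horizontal part is `φ`-invariant. On the horizontal space, `N = 0` and `dΦ = 0` amount to the
  `φ`-invariance of `w k` for `k ≠ 4`, which is the equivalence of `∇φ = 0` with integrability and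
  closedness in Hermitian geometry (`nij_dPhi_killing_iff`). The components of `N` and `dΦ` with an
  index `4` give in addition that `A` is skew and that `A` and `w 4` are `φ`-invariant
  (`nij_dPhi_iff`).
-/

noncomputable section

namespace ACM

set_option linter.unusedSectionVars false

/-! ### The Hodge operator and the modules `Λ²_2`, `Λ²_3` -/

/-- The sign of `y - x`. -/
def orderSign (x y : Fin 5) : ℤ := if x < y then 1 else if y < x then -1 else 0

/-- The Levi-Civita symbol as a product of ten signs, a form on which `decide` is fast. -/
lemma eps_eq (a b c d e : Fin 5) : eps ![a, b, c, d, e] =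
    orderSign a b * orderSign a c * orderSign a d * orderSign a e * orderSign b c *
      orderSign b d * orderSign b e * orderSign c d * orderSign c e * orderSign d e := by
  have h0 : Finset.Ioi (0 : Fin 5) = {1, 2, 3, 4} := by decide
  have h1 : Finset.Ioi (1 : Fin 5) = {2, 3, 4} := by decide
  have h2 : Finset.Ioi (2 : Fin 5) = {3, 4} := by decide
  have h3 : Finset.Ioi (3 : Fin 5) = {4} := by decide
  have h4 : Finset.Ioi (4 : Fin 5) = ∅ := by decide
  change ∏ i, ∏ j ∈ Finset.Ioi i, orderSign (![a, b, c, d, e] i) (![a, b, c, d, e] j) = _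
  simp [Fin.prod_univ_five, h0, h1, h2, h3, h4, mul_assoc]

/-- The identity of symbols behind `*β = η ∧ *₄β` for horizontal `β`. -/
lemma eps_horizontal (l m i j k : Fin 5) (hl : l ≠ 4) (hm : m ≠ 4) : eps ![l, m, i, j, k] =
    (if i = 4 then eps ![l, m, j, k, 4] else 0) + (if j = 4 then eps ![l, m, k, i, 4] else 0)
      + (if k = 4 then eps ![l, m, i, j, 4] else 0) := by
  simp only [eps_eq]
  revert l m i j k
  decide +kernel

lemma eps_eq_of_eps_eq_one {l m i j k : Fin 5} (h : eps ![l, m, i, j, k] = 1) (a b : Fin 5) :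
    eps ![a, b, i, j, k] =
      (if a = l ∧ b = m then 1 else 0) - (if a = m ∧ b = l then 1 else 0) := by
  simp only [eps_eq] at h ⊢
  revert l m i j k a b
  decide +kernel

lemma mem_so5_iff {A : Mat} : A ∈ so5 ↔ ∀ i j, A i j = -A j i :=
  ⟨fun h i j => congrFun (congrFun h j) i, fun h => by ext i j; exact h j i⟩

lemma hodge_apply (β : Mat) (i j k : Fin 5) :
    hodge β i j k = (1 / 2 : ℝ) * ∑ l, ∑ m, (eps ![l, m, i, j, k] : ℝ) * β l m := rfl

lemma etaWedge_apply (β : Mat) (i j k : Fin 5) :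
    etaWedge β i j k = eta0 i * β j k + eta0 j * β k i + eta0 k * β i j := rfl

lemma eta0_apply (i : Fin 5) : eta0 i = if i = 4 then 1 else 0 := by
  simp [eta0, Pi.single_apply]

/-- `*β(e_i, e_j, e_k) = β(e_l, e_m)` if `(l, m, i, j, k)` is an even permutation. -/
lemma hodge_apply_of_even {β : Mat} (hβ : β ∈ so5) {i j k : Fin 5} (l m : Fin 5)
    (h : eps ![l, m, i, j, k] = 1) : hodge β i j k = β l m := by
  rw [hodge_apply]
  simp only [eps_eq_of_eps_eq_one h, ite_and]
  simp [sub_mul, Finset.sum_sub_distrib, mem_so5_iff.1 hβ m l]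
  ring

/-- The four-dimensional Hodge operator on `e_4^⊥`. -/
def star4 (β : Mat) : Mat := Matrix.of fun i j => hodge β i j 4

lemma star4_apply_of_even {β : Mat} (hβ : β ∈ so5) {i j : Fin 5} (l m : Fin 5)
    (h : eps ![l, m, i, j, 4] = 1) : star4 β i j = β l m := by
  rw [star4, Matrix.of_apply, hodge_apply_of_even hβ l m h]

/-- On horizontal two-forms `*β = η ∧ *₄β`. -/
lemma hodge_eq_etaWedge_star4 {β : Mat} (h : ∀ i, β i 4 = 0) (h' : ∀ i, β 4 i = 0) :
    hodge β = etaWedge (star4 β) := by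
  ext i j k
  simp only [hodge_apply, etaWedge_apply, star4, Matrix.of_apply, eta0_apply]
  have key (l m : Fin 5) : (eps ![l, m, i, j, k] : ℝ) * β l m =
      (if i = 4 then 1 else 0) * ((eps ![l, m, j, k, 4] : ℝ) * β l m)
      + (if j = 4 then 1 else 0) * ((eps ![l, m, k, i, 4] : ℝ) * β l m)
      + (if k = 4 then 1 else 0) * ((eps ![l, m, i, j, 4] : ℝ) * β l m) := by
    by_cases hl : l = 4
    · simp [hl, h']
    by_cases hm : m = 4
    · simp [hm, h]
    rw [eps_horizontal l m i j k hl hm]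
    push_cast
    split_ifs <;> ring
  simp only [key, Finset.sum_add_distrib, ← Finset.mul_sum]
  ring

lemma eps_eq_zero_of_left (l m i : Fin 5) : eps ![l, m, 4, i, 4] = 0 := by
  rw [eps_eq]
  simp [orderSign]

lemma eps_swap (l m i j : Fin 5) : eps ![l, m, j, i, 4] = -eps ![l, m, i, j, 4] := by
  simp only [eps_eq]
  revert l m i j
  decide +kernel

lemma star4_apply_symm (β : Mat) (i j : Fin 5) : star4 β i j = -star4 β j i := by
  simp only [star4, Matrix.of_apply, hodge_apply]
  simp only [eps_swap _ _ j i, Int.cast_neg, neg_mul, Finset.sum_neg_distrib]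
  ring

lemma star4_four (β : Mat) (i : Fin 5) : star4 β 4 i = 0 := by
  simp [star4, hodge_apply, eps_eq_zero_of_left]

lemma star4_eq {β : Mat} (hβ : β ∈ so5) : star4 β =
    !![0, β 2 3, -β 1 3, β 1 2, 0;
       -β 2 3, 0, β 0 3, -β 0 2, 0;
       β 1 3, -β 0 3, 0, β 0 1, 0;
       -β 1 2, β 0 2, -β 0 1, 0, 0;
       0, 0, 0, 0, 0] := by
  have e01 : star4 β 0 1 = β 2 3 :=
    star4_apply_of_even hβ 2 3 (by simp [eps_eq, orderSign])
  have e02 : star4 β 0 2 = β 3 1 :=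
    star4_apply_of_even hβ 3 1 (by simp [eps_eq, orderSign])
  have e03 : star4 β 0 3 = β 1 2 :=
    star4_apply_of_even hβ 1 2 (by simp [eps_eq, orderSign])
  have e12 : star4 β 1 2 = β 0 3 :=
    star4_apply_of_even hβ 0 3 (by simp [eps_eq, orderSign])
  have e13 : star4 β 1 3 = β 2 0 :=
    star4_apply_of_even hβ 2 0 (by simp [eps_eq, orderSign])
  have e23 : star4 β 2 3 = β 0 1 :=
    star4_apply_of_even hβ 0 1 (by simp [eps_eq, orderSign])
  have hs := star4_apply_symm β
  have hd (i : Fin 5) : star4 β i i = 0 := by linarith [hs i i]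
  have h4 := star4_four β
  have h4' (i : Fin 5) : star4 β i 4 = 0 := by rw [hs, h4, neg_zero]
  have h31 := mem_so5_iff.1 hβ 3 1
  have h20 := mem_so5_iff.1 hβ 2 0
  ext i j
  fin_cases i <;> fin_cases j <;>
    simp [hd, h4, h4', e01, e02, e03, e12, e13, e23, hs 1 0, hs 2 0, hs 3 0, hs 2 1, hs 3 1,
      hs 3 2, h31, h20]

/-- If `*β = c η ∧ β` then `β` is horizontal, that is `β(e_4, ·) = 0`, and `*₄ β = c β`. -/
lemma horizontal_of_hodge_eq {β : Mat} (hβ : β ∈ so5) {c : ℝ} (h : hodge β = c • etaWedge β) :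
    (∀ i, β i 4 = 0) ∧ star4 β = c • β := by
  have hs := mem_so5_iff.1 hβ
  have ht (i j k : Fin 5) : hodge β i j k = c * etaWedge β i j k := by rw [h]; rfl
  have h012 := ht 0 1 2
  have h013 := ht 0 1 3
  have h023 := ht 0 2 3
  have h123 := ht 1 2 3
  rw [hodge_apply_of_even hβ 3 4 (by simp [eps_eq, orderSign])] at h012
  rw [hodge_apply_of_even hβ 4 2 (by simp [eps_eq, orderSign])] at h013
  rw [hodge_apply_of_even hβ 1 4 (by simp [eps_eq, orderSign])] at h023
  rw [hodge_apply_of_even hβ 4 0 (by simp [eps_eq, orderSign])] at h123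
  simp [etaWedge_apply, eta0_apply] at h012 h013 h023 h123
  have h4 (i : Fin 5) : β i 4 = 0 := by
    fin_cases i
    · exact (hs 0 4).trans (by rw [h123, neg_zero])
    · exact h023
    · exact (hs 2 4).trans (by rw [h013, neg_zero])
    · exact h012
    · have := hs 4 4; change β 4 4 = 0; linarith
  refine ⟨h4, ?_⟩
  ext i j
  have h4' (i : Fin 5) : β 4 i = 0 := by rw [hs, h4, neg_zero]
  simp only [star4, Matrix.of_apply, ht, etaWedge_apply, eta0_apply, h4, h4', Matrix.smul_apply]
  simp

/-- The general element `a (e_0 ∧ e_2 - e_1 ∧ e_3) + b (e_0 ∧ e_3 + e_1 ∧ e_2)` of `Λ²_2`. -/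
def selfDual (a b : ℝ) : Mat :=
  !![0, 0, a, b, 0;
     0, 0, b, -a, 0;
     -a, -b, 0, 0, 0;
     -b, a, 0, 0, 0;
     0, 0, 0, 0, 0]

/-- The general element
`a (e_0 ∧ e_1 - e_2 ∧ e_3) + b (e_0 ∧ e_2 + e_1 ∧ e_3) + c (e_0 ∧ e_3 - e_1 ∧ e_2)` of `Λ²_3`. -/
def antiSelfDual (a b c : ℝ) : Mat :=
  !![0, a, b, c, 0;
     -a, 0, -c, b, 0;
     -b, c, 0, -a, 0;
     -c, -b, a, 0, 0;
     0, 0, 0, 0, 0]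

lemma selfDual_mem_so5 (a b : ℝ) : selfDual a b ∈ so5 := by
  refine mem_so5_iff.2 fun i j => ?_
  fin_cases i <;> fin_cases j <;> simp [selfDual]

lemma antiSelfDual_mem_so5 (a b c : ℝ) : antiSelfDual a b c ∈ so5 := by
  refine mem_so5_iff.2 fun i j => ?_
  fin_cases i <;> fin_cases j <;> simp [antiSelfDual]

lemma hodge_Phi0 : hodge Phi0 = etaWedge Phi0 := by
  rw [hodge_eq_etaWedge_star4 (fun i => by fin_cases i <;> simp [Phi0])
    (fun i => by fin_cases i <;> simp [Phi0]), star4_eq Phi0_mem]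
  congr 1
  ext i j
  fin_cases i <;> fin_cases j <;> simp [Phi0]

lemma hodge_selfDual (a b : ℝ) : hodge (selfDual a b) = etaWedge (selfDual a b) := by
  rw [hodge_eq_etaWedge_star4 (fun i => by fin_cases i <;> simp [selfDual])
    (fun i => by fin_cases i <;> simp [selfDual]), star4_eq (selfDual_mem_so5 a b)]
  congr 1
  ext i j
  fin_cases i <;> fin_cases j <;> simp [selfDual]

lemma hodge_antiSelfDual (a b c : ℝ) :
    hodge (antiSelfDual a b c) = -etaWedge (antiSelfDual a b c) := by
  rw [hodge_eq_etaWedge_star4 (fun i => by fin_cases i <;> simp [antiSelfDual])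
    (fun i => by fin_cases i <;> simp [antiSelfDual]), star4_eq (antiSelfDual_mem_so5 a b c),
    ← map_neg]
  congr 1
  ext i j
  fin_cases i <;> fin_cases j <;> simp [antiSelfDual]

-- All components are integral multiples of `a` and `b`, so the claim is decided over `ℤ`.
lemma phiWedge_selfDual (a b : ℝ) : phiWedge (selfDual a b) = 0 := by
  let P : Matrix (Fin 5) (Fin 5) ℤ :=
    !![0, 1, 0, 0, 0; -1, 0, 0, 0, 0; 0, 0, 0, 1, 0; 0, 0, -1, 0, 0; 0, 0, 0, 0, 0]
  let A : Matrix (Fin 5) (Fin 5) ℤ :=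
    !![0, 0, 1, 0, 0; 0, 0, 0, -1, 0; -1, 0, 0, 0, 0; 0, 1, 0, 0, 0; 0, 0, 0, 0, 0]
  let B : Matrix (Fin 5) (Fin 5) ℤ :=
    !![0, 0, 0, 1, 0; 0, 0, 1, 0, 0; 0, -1, 0, 0, 0; -1, 0, 0, 0, 0; 0, 0, 0, 0, 0]
  have hA : ∀ i j k l, P i j * A k l - P i k * A j l + P i l * A j k
      + P j k * A i l - P j l * A i k + P k l * A i j = 0 := by decide +kernel
  have hB : ∀ i j k l, P i j * B k l - P i k * B j l + P i l * B j k
      + P j k * B i l - P j l * B i k + P k l * B i j = 0 := by decide +kernel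
  have hP (i j : Fin 5) : Phi0 i j = (P i j : ℝ) := by
    fin_cases i <;> fin_cases j <;> simp [Phi0, P]
  have hβ (i j : Fin 5) : selfDual a b i j = a * (A i j : ℝ) + b * (B i j : ℝ) := by
    fin_cases i <;> fin_cases j <;> simp [selfDual, A, B]
  ext i j k l
  have h1 := congrArg (Int.cast : ℤ → ℝ) (hA i j k l)
  have h2 := congrArg (Int.cast : ℤ → ℝ) (hB i j k l)
  push_cast at h1 h2
  simp only [phiWedge, LinearMap.coe_mk, AddHom.coe_mk, Matrix.of_apply, hP, hβ]
  change _ = (0 : ℝ)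
  linear_combination a * h1 + b * h2

lemma selfDual_mem_L2 (a b : ℝ) : selfDual a b ∈ L2 :=
  ⟨⟨selfDual_mem_so5 a b, phiWedge_selfDual a b⟩, hodge_selfDual a b⟩

lemma antiSelfDual_mem_L3 (a b c : ℝ) : antiSelfDual a b c ∈ L3 :=
  ⟨antiSelfDual_mem_so5 a b c, by
    simp only [SetLike.mem_coe, LinearMap.mem_eqLocus, LinearMap.neg_apply]
    exact hodge_antiSelfDual a b c⟩

lemma exists_of_mem_L2 {β : Mat} (h : β ∈ L2) : ∃ a b, β = selfDual a b := by
  obtain ⟨⟨hβ, hΦ⟩, hh⟩ := h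
  obtain ⟨h4, hst⟩ := horizontal_of_hodge_eq (c := 1) hβ (by rw [one_smul]; exact hh)
  have hs := mem_so5_iff.1 hβ
  have hd (i : Fin 5) : β i i = 0 := by linarith [hs i i]
  have h4' (i : Fin 5) : β 4 i = 0 := by rw [hs, h4, neg_zero]
  rw [star4_eq hβ, one_smul] at hst
  have e01 := congrFun (congrFun hst 0) 1
  have e02 := congrFun (congrFun hst 0) 2
  have e03 := congrFun (congrFun hst 0) 3
  have eΦ : phiWedge β 0 1 2 3 = 0 := by rw [LinearMap.mem_ker.1 hΦ]; rfl
  simp [phiWedge, Phi0] at e01 e02 e03 eΦ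
  refine ⟨β 0 2, β 0 3, ?_⟩
  ext i j
  fin_cases i <;> fin_cases j <;> simp [selfDual, h4, h4', hd] <;>
    linarith [hs 1 0, hs 2 0, hs 3 0, hs 2 1, hs 3 1, hs 3 2]

lemma exists_of_mem_L3 {β : Mat} (h : β ∈ L3) : ∃ a b c, β = antiSelfDual a b c := by
  obtain ⟨hβ, hh⟩ := h
  obtain ⟨h4, hst⟩ := horizontal_of_hodge_eq (c := -1) hβ (by rw [neg_one_smul]; exact hh)
  have hs := mem_so5_iff.1 hβ
  have hd (i : Fin 5) : β i i = 0 := by linarith [hs i i]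
  have h4' (i : Fin 5) : β 4 i = 0 := by rw [hs, h4, neg_zero]
  rw [star4_eq hβ, neg_one_smul] at hst
  have e01 := congrFun (congrFun hst 0) 1
  have e02 := congrFun (congrFun hst 0) 2
  have e03 := congrFun (congrFun hst 0) 3
  simp at e01 e02 e03
  refine ⟨β 0 1, β 0 2, β 0 3, ?_⟩
  ext i j
  fin_cases i <;> fin_cases j <;> simp [antiSelfDual, h4, h4', hd] <;>
    linarith [hs 1 0, hs 2 0, hs 3 0, hs 2 1, hs 3 1, hs 3 2]

/-! ### The classes `W₃, W₄, W₅, W₇` in components -/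

/-- The two linear equations in the horizontal components by which, in `so(5)`, `A` is orthogonal
to `Λ²_2`. Together with `A(e_4, ·) = 0` they say `A ∈ u(2)`. -/
def PerpL2 (A : Mat) : Prop := A 0 2 = A 1 3 ∧ A 0 3 = -A 1 2

lemma Phi0_mul_Phi0 : Phi0 * Phi0 = -Matrix.diagonal fun i => if i = 4 then 0 else 1 := by
  ext i j
  fin_cases i <;> fin_cases j <;> simp [Phi0, Matrix.mul_apply, Fin.sum_univ_five]

lemma prPerp_apply (A : Mat) (i j : Fin 5) : prPerp A i j =
    A i j - (1 / 2) * ((if i = 4 then 0 else 1) * A i j * (if j = 4 then 0 else 1)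
      - ∑ a, ∑ b, Phi0 i a * A a b * Phi0 b j) := by
  have h : (Phi0 * A * Phi0) i j = ∑ a, ∑ b, Phi0 i a * A a b * Phi0 b j := by
    rw [Finset.sum_comm]
    simp only [Matrix.mul_apply, Finset.sum_mul]
  change A i j - (1 / 2) * ((Phi0 * Phi0 * A * (Phi0 * Phi0)) i j - (Phi0 * A * Phi0) i j) = _
  rw [h, Phi0_mul_Phi0, neg_mul, neg_mul_neg, Matrix.mul_diagonal, Matrix.diagonal_mul]

lemma prPerp_entries (A : Mat) :
    prPerp A 0 2 = (A 0 2 - A 1 3) / 2 ∧ prPerp A 1 3 = -((A 0 2 - A 1 3) / 2) ∧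
    prPerp A 0 3 = (A 0 3 + A 1 2) / 2 ∧ prPerp A 1 2 = (A 0 3 + A 1 2) / 2 ∧
    ∀ i, prPerp A 4 i = A 4 i := by
  refine ⟨?_, ?_, ?_, ?_, fun i => ?_⟩
  · simp [prPerp_apply, Phi0, Fin.sum_univ_five]; ring
  · simp [prPerp_apply, Phi0, Fin.sum_univ_five]; ring
  · simp [prPerp_apply, Phi0, Fin.sum_univ_five]; ring
  · simp [prPerp_apply, Phi0, Fin.sum_univ_five]; ring
  · simp [prPerp_apply, Phi0, Fin.sum_univ_five]

lemma prPerp_congr {A B : Mat} (hA : A ∈ so5) (hB : B ∈ so5) (h4 : ∀ i, A 4 i = B 4 i)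
    (h1 : A 0 2 - A 1 3 = B 0 2 - B 1 3) (h2 : A 0 3 + A 1 2 = B 0 3 + B 1 2) :
    prPerp A = prPerp B := by
  have hs := mem_so5_iff.1 hA
  have hs' := mem_so5_iff.1 hB
  have ha (i : Fin 5) : A i i = 0 := by linarith [hs i i]
  have hb (i : Fin 5) : B i i = 0 := by linarith [hs' i i]
  have h4' (i : Fin 5) : A i 4 = B i 4 := by rw [hs, hs', h4]
  ext i j
  fin_cases i <;> fin_cases j <;>
    simp [prPerp_apply, Phi0, Fin.sum_univ_five, ha, hb, h4, h4'] <;>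
    linarith [hs 1 0, hs 2 0, hs 3 0, hs 2 1, hs 3 1, hs 3 2,
      hs' 1 0, hs' 2 0, hs' 3 0, hs' 2 1, hs' 3 1, hs' 3 2]

lemma prW_apply (T : Ten3) (k : Fin 5) : prW T k = prPerp (T k) := rfl

lemma etaWedge_mem_so5 {β : Mat} (hβ : β ∈ so5) (k : Fin 5) : etaWedge β k ∈ so5 := by
  refine mem_so5_iff.2 fun i j => ?_
  rw [etaWedge_apply, etaWedge_apply, mem_so5_iff.1 hβ i j, mem_so5_iff.1 hβ k j,
    mem_so5_iff.1 hβ k i]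
  ring

/-- The equations, in terms of `Γ ∈ Λ¹ ⊗ u(2)^⊥`, of `W₃ ⊕ W₄ ⊕ W₅ ⊕ W₇`. -/
def genClass : Submodule ℝ Ten3 where
  carrier := {T | (∀ k, k ≠ 4 → PerpL2 (T k)) ∧ ∀ k i, T k 4 i = -T i 4 k}
  zero_mem' := by simp [PerpL2]
  add_mem' := by
    rintro S T ⟨hS, hS'⟩ ⟨hT, hT'⟩
    refine ⟨fun k hk => ⟨?_, ?_⟩, fun k i => ?_⟩
    · simp [(hS k hk).1, (hT k hk).1]
    · simp [(hS k hk).2, (hT k hk).2]; ring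
    · simp [hS' k i, hT' k i]; ring
  smul_mem' := by
    rintro c T ⟨hT, hT'⟩
    refine ⟨fun k hk => ⟨?_, ?_⟩, fun k i => ?_⟩
    · simp [(hT k hk).1]
    · simp [(hT k hk).2]
    · simp [hT' k i]

/-- The equations, in terms of `Γ ∈ Λ¹ ⊗ u(2)^⊥`, of `W₃ ⊕ W₅`. -/
def quasiSasakiClass : Submodule ℝ Ten3 where
  carrier := {T | (∀ k, PerpL2 (T k)) ∧ (∀ k i, T k 4 i = -T i 4 k) ∧ PerpL2 fun k => T k 4}
  zero_mem' := by simp [PerpL2]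
  add_mem' := by
    rintro S T ⟨hS, hS', hS''⟩ ⟨hT, hT', hT''⟩
    refine ⟨fun k => ⟨?_, ?_⟩, fun k i => ?_, ⟨?_, ?_⟩⟩
    · simp [(hS k).1, (hT k).1]
    · simp [(hS k).2, (hT k).2]; ring
    · simp [hS' k i, hT' k i]; ring
    · simp [hS''.1, hT''.1]
    · simp [hS''.2, hT''.2]; ring
  smul_mem' := by
    rintro c T ⟨hT, hT', hT''⟩
    refine ⟨fun k => ⟨?_, ?_⟩, fun k i => ?_, ⟨?_, ?_⟩⟩
    · simp [(hT k).1]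
    · simp [(hT k).2]
    · simp [hT' k i]
    · simp [hT''.1]
    · simp [hT''.2]

lemma prW_mem_genClass_iff {w : Ten3} :
    prW w ∈ genClass ↔ (∀ k, k ≠ 4 → PerpL2 (w k)) ∧ ∀ k i, w k 4 i = -w i 4 k := by
  have h (k : Fin 5) : PerpL2 (prPerp (w k)) ↔ PerpL2 (w k) := by
    obtain ⟨h1, h2, h3, h4, -⟩ := prPerp_entries (w k)
    rw [PerpL2, PerpL2, h1, h2, h3, h4]
    constructor <;> rintro ⟨a, b⟩ <;> constructor <;> linarith
  have h' (k i : Fin 5) : prPerp (w k) 4 i = w k 4 i := (prPerp_entries (w k)).2.2.2.2 i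
  change (_ ∧ _) ↔ _
  simp only [prW_apply, h, h']

lemma prW_mem_quasiSasakiClass_iff {w : Ten3} :
    prW w ∈ quasiSasakiClass ↔
      (∀ k, PerpL2 (w k)) ∧ (∀ k i, w k 4 i = -w i 4 k) ∧ PerpL2 fun k => w k 4 := by
  have h (k : Fin 5) : PerpL2 (prPerp (w k)) ↔ PerpL2 (w k) := by
    obtain ⟨h1, h2, h3, h4, -⟩ := prPerp_entries (w k)
    rw [PerpL2, PerpL2, h1, h2, h3, h4]
    constructor <;> rintro ⟨a, b⟩ <;> constructor <;> linarith
  have h' (k i : Fin 5) : prPerp (w k) 4 i = w k 4 i := (prPerp_entries (w k)).2.2.2.2 i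
  change (_ ∧ _ ∧ _) ↔ _
  simp only [PerpL2] at h ⊢
  simp only [prW_apply, h, h']

lemma W3_le : W3 ≤ quasiSasakiClass := by
  rintro _ ⟨β, hβ, rfl⟩
  obtain ⟨c, rfl⟩ := Submodule.mem_span_singleton.1 hβ
  simp only [map_smul]
  refine Submodule.smul_mem _ _ ?_
  change prW (hodge Phi0) ∈ _
  rw [hodge_Phi0, prW_mem_quasiSasakiClass_iff]
  refine ⟨fun k => ?_, fun k i => ?_, ?_⟩
  · simp [PerpL2, etaWedge_apply, eta0_apply, Phi0]
  · fin_cases k <;> fin_cases i <;> simp [etaWedge_apply, eta0_apply, Phi0]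
  · simp [PerpL2, etaWedge_apply, eta0_apply, Phi0]

lemma W5_le : W5 ≤ quasiSasakiClass := by
  rintro _ ⟨β, hβ, rfl⟩
  obtain ⟨a, b, c, rfl⟩ := exists_of_mem_L3 hβ
  change prW (hodge _) ∈ _
  rw [hodge_antiSelfDual, map_neg, neg_mem_iff,
    prW_mem_quasiSasakiClass_iff]
  refine ⟨fun k => ?_, fun k i => ?_, ?_⟩
  · simp [PerpL2, etaWedge_apply, eta0_apply, antiSelfDual]
  · fin_cases k <;> fin_cases i <;> simp [etaWedge_apply, eta0_apply, antiSelfDual]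
  · simp [PerpL2, etaWedge_apply, eta0_apply, antiSelfDual]

lemma quasiSasakiClass_le : quasiSasakiClass ≤ genClass := fun _ h => ⟨fun k _ => h.1 k, h.2.1⟩

lemma prW_etaWedge_selfDual_mem (a b : ℝ) : prW (etaWedge (selfDual a b)) ∈ genClass := by
  rw [prW_mem_genClass_iff]
  refine ⟨fun k hk => ?_, fun k i => ?_⟩
  · simp [PerpL2, etaWedge_apply, eta0_apply, hk]
  · fin_cases k <;> fin_cases i <;> simp [etaWedge_apply, eta0_apply, selfDual]

lemma etaTensor_apply (β : Mat) (k : Fin 5) : etaTensor β k = eta0 k • β := rfl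

lemma etaTensor_mem_so5 {β : Mat} (hβ : β ∈ so5) (k : Fin 5) : etaTensor β k ∈ so5 :=
  so5.smul_mem _ hβ

lemma prW_etaTensor_selfDual_mem (a b : ℝ) : prW (etaTensor (selfDual a b)) ∈ genClass := by
  rw [prW_mem_genClass_iff]
  refine ⟨fun k hk => ?_, fun k i => ?_⟩
  · simp [PerpL2, etaTensor_apply, eta0_apply, hk]
  · fin_cases k <;> fin_cases i <;> simp [etaTensor_apply, eta0_apply, selfDual]

lemma W4_le : W4 ≤ genClass := by
  rintro _ ⟨β, hβ, rfl⟩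
  obtain ⟨a, b, rfl⟩ := exists_of_mem_L2 hβ
  change prW (hodge _) ∈ _
  rw [hodge_selfDual]
  exact prW_etaWedge_selfDual_mem a b

lemma W7_le : W7 ≤ genClass := by
  rintro _ ⟨β, hβ, rfl⟩
  obtain ⟨a, b, rfl⟩ := exists_of_mem_L2 hβ
  change prW ((3 : ℝ) • etaTensor _ - hodge _) ∈ _
  rw [hodge_selfDual, map_sub, map_smul]
  exact genClass.sub_mem (genClass.smul_mem _ (prW_etaTensor_selfDual_mem a b))
    (prW_etaWedge_selfDual_mem a b)

lemma prW_etaWedge_Phi0_mem : prW (etaWedge Phi0) ∈ W3 :=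
  ⟨Phi0, Submodule.mem_span_singleton_self _, by rw [← hodge_Phi0]; rfl⟩

lemma prW_etaWedge_antiSelfDual_mem (a b c : ℝ) : prW (etaWedge (antiSelfDual a b c)) ∈ W5 := by
  rw [← neg_mem_iff, ← map_neg, ← hodge_antiSelfDual]
  exact ⟨_, antiSelfDual_mem_L3 a b c, rfl⟩

/-- An element of `W` that satisfies the equations of `genClass` is determined by the horizontal
two-form `w k 4 i` and by the `Λ²_2`-part of `w 4`; the four summands are the parts of the former in
`ℝ Φ`, `Λ²_3` and `Λ²_2`, and a correction of the latter. -/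
lemma prW_eq_of_mem_genClass {w : Ten3} (hw : ∀ k, w k ∈ so5) (h : prW w ∈ genClass) :
    prW w = (-((w 0 4 1 + w 2 4 3) / 2)) • prW (etaWedge Phi0)
      - prW (etaWedge (antiSelfDual ((w 0 4 1 - w 2 4 3) / 2) ((w 0 4 2 + w 1 4 3) / 2)
        ((w 0 4 3 - w 1 4 2) / 2)))
      - prW (etaWedge (selfDual ((w 0 4 2 - w 1 4 3) / 2) ((w 0 4 3 + w 1 4 2) / 2)))
      + prW (etaTensor (selfDual ((w 4 0 2 - w 4 1 3) / 2 + (w 0 4 2 - w 1 4 3) / 2)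
        ((w 4 0 3 + w 4 1 2) / 2 + (w 0 4 3 + w 1 4 2) / 2))) := by
  rw [prW_mem_genClass_iff] at h
  obtain ⟨hP, hK⟩ := h
  have hs (k : Fin 5) := mem_so5_iff.1 (hw k)
  have h44 (k : Fin 5) : w k 4 4 = 0 := by linarith [hs k 4 4]
  have h444 (i : Fin 5) : w 4 4 i = 0 := by rw [hK, h44, neg_zero]
  have hd (k : Fin 5) : w k 4 k = 0 := by linarith [hK k k]
  rw [← map_smul, ← map_sub, ← map_sub, ← map_add]
  funext k
  rw [prW_apply, prW_apply]
  refine prPerp_congr (hw k) ?_ (fun i => ?_) ?_ ?_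
  · exact so5.add_mem (so5.sub_mem (so5.sub_mem (so5.smul_mem _ (etaWedge_mem_so5 Phi0_mem k))
      (etaWedge_mem_so5 (antiSelfDual_mem_so5 _ _ _) k))
      (etaWedge_mem_so5 (selfDual_mem_so5 _ _) k)) (etaTensor_mem_so5 (selfDual_mem_so5 _ _) k)
  · simp only [Pi.add_apply, Pi.sub_apply, Pi.smul_apply, Matrix.add_apply, Matrix.sub_apply,
      Matrix.smul_apply, etaWedge_apply, eta0_apply, etaTensor_apply, smul_eq_mul]
    fin_cases k <;> fin_cases i <;> simp [Phi0, antiSelfDual, selfDual, h44, h444, hd] <;>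
      linarith [hK 1 0, hK 2 0, hK 3 0, hK 2 1, hK 3 1, hK 3 2]
  all_goals
    simp only [Pi.add_apply, Pi.sub_apply, Pi.smul_apply, Matrix.add_apply, Matrix.sub_apply,
      Matrix.smul_apply, etaWedge_apply, eta0_apply, etaTensor_apply, smul_eq_mul]
    by_cases hk : k = 4
    · subst hk
      simp [Phi0, antiSelfDual, selfDual] <;> ring
    · simp [hk, (hP k hk).1, (hP k hk).2]

theorem prW_mem_sup_iff {w : Ten3} (hw : ∀ k, w k ∈ so5) :
    prW w ∈ W3 ⊔ W4 ⊔ W5 ⊔ W7 ↔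
      (∀ k, k ≠ 4 → PerpL2 (w k)) ∧ ∀ k i, w k 4 i = -w i 4 k := by
  rw [← prW_mem_genClass_iff]
  refine ⟨fun h => ?_, fun h => ?_⟩
  · exact sup_le (sup_le (sup_le (W3_le.trans quasiSasakiClass_le) W4_le)
      (W5_le.trans quasiSasakiClass_le)) W7_le h
  · rw [prW_eq_of_mem_genClass hw h]
    have h3 : W3 ≤ W3 ⊔ W4 ⊔ W5 ⊔ W7 := le_sup_left.trans (le_sup_left.trans le_sup_left)
    have h4 : W4 ≤ W3 ⊔ W4 ⊔ W5 ⊔ W7 := le_sup_right.trans (le_sup_left.trans le_sup_left)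
    have h5 : W5 ≤ W3 ⊔ W4 ⊔ W5 ⊔ W7 := le_sup_right.trans le_sup_left
    have h7 : W7 ≤ W3 ⊔ W4 ⊔ W5 ⊔ W7 := le_sup_right
    have m4 (a b : ℝ) : prW (etaWedge (selfDual a b)) ∈ W3 ⊔ W4 ⊔ W5 ⊔ W7 :=
      h4 ⟨_, selfDual_mem_L2 a b, by rw [← hodge_selfDual]; rfl⟩
    -- `3 η ⊗ β = ϑ(β) + θ(β)`
    have m7 (a b : ℝ) : prW (etaTensor (selfDual a b)) ∈ W3 ⊔ W4 ⊔ W5 ⊔ W7 := by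
      have h : prW (vartheta (selfDual a b)) ∈ W3 ⊔ W4 ⊔ W5 ⊔ W7 :=
        h7 ⟨_, selfDual_mem_L2 a b, rfl⟩
      have e : vartheta (selfDual a b)
          = (3 : ℝ) • etaTensor (selfDual a b) - etaWedge (selfDual a b) := by
        rw [← hodge_selfDual]; rfl
      rw [e, map_sub, map_smul] at h
      have h' := Submodule.add_mem _ h (m4 a b)
      rw [sub_add_cancel] at h'
      exact (Submodule.smul_mem_iff _ three_ne_zero).1 h'
    exact add_mem (sub_mem (sub_mem (Submodule.smul_mem _ _ (h3 prW_etaWedge_Phi0_mem))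
      (h5 (prW_etaWedge_antiSelfDual_mem _ _ _))) (m4 _ _)) (m7 _ _)

theorem prW_mem_W3_sup_W5_iff {w : Ten3} (hw : ∀ k, w k ∈ so5) :
    prW w ∈ W3 ⊔ W5 ↔
      (∀ k, PerpL2 (w k)) ∧ (∀ k i, w k 4 i = -w i 4 k) ∧ PerpL2 fun k => w k 4 := by
  rw [← prW_mem_quasiSasakiClass_iff]
  refine ⟨fun h => sup_le W3_le W5_le h, fun h => ?_⟩
  rw [prW_eq_of_mem_genClass hw (quasiSasakiClass_le h)]
  obtain ⟨hP, -, hA⟩ := prW_mem_quasiSasakiClass_iff.1 h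
  have z : selfDual 0 0 = 0 := by ext i j; fin_cases i <;> fin_cases j <;> simp [selfDual]
  obtain ⟨a1, a2⟩ := hA
  obtain ⟨p1, p2⟩ := hP 4
  simp only at a1 a2
  rw [show w 0 4 2 - w 1 4 3 = 0 by linarith, show w 0 4 3 + w 1 4 2 = 0 by linarith,
    show w 4 0 2 - w 4 1 3 = 0 by linarith, show w 4 0 3 + w 4 1 2 = 0 by linarith,
    zero_div, add_zero, z, map_zero, map_zero, map_zero, sub_zero, map_zero, add_zero]
  exact sub_mem (Submodule.smul_mem _ _ (Submodule.mem_sup_left prW_etaWedge_Phi0_mem))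
    (Submodule.mem_sup_right (prW_etaWedge_antiSelfDual_mem _ _ _))

/-! ### `N` and `dΦ` in an adapted frame -/

/-- The index `σ i` with `φ(e_i) = ± e_{σ i}`. -/
def phiIndex : Fin 5 → Fin 5 := ![1, 0, 3, 2, 4]

/-- The coefficient `s i` in `φ(e_i) = s i • e_{σ i}`. -/
def phiSign : Fin 5 → ℝ := ![-1, 1, -1, 1, 0]

local notation "σ" => phiIndex
local notation "s" => phiSign

/-- The components `g([e_i, e_j], e_k)` of the Lie brackets, in terms of the components
`w i j k = g(∇_{e_i} e_j, e_k)` of a torsion-free connection. -/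
def structConst (w : Ten3) (i j k : Fin 5) : ℝ := w i j k - w j i k

/-- The components `N(e_k, e_i, e_j)` of the Nijenhuis tensor in an adapted frame. As
`φ² = -Id + η ⊗ ξ`, the `ξ`-component of `φ²[e_i, e_j]` is missing; it is supplied by `η ⊗ dη`. -/
def nijComp (w : Ten3) (k i j : Fin 5) : ℝ :=
  s i * s j * structConst w (σ i) (σ j) k - structConst w i j k
    + s k * s i * structConst w (σ i) j (σ k) + s k * s j * structConst w i (σ j) (σ k)

/-- The components `dΦ(e_i, e_j, e_k)` in an adapted frame. -/
def dPhiComp (w : Ten3) (i j k : Fin 5) : ℝ :=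
  -s k * structConst w i j (σ k) + s j * structConst w i k (σ j) - s i * structConst w j k (σ i)

@[simp] lemma phiIndex_phiIndex (i : Fin 5) : σ (σ i) = i := by fin_cases i <;> rfl

@[simp] lemma phiIndex_four : σ 4 = 4 := rfl

@[simp] lemma phiSign_four : s 4 = 0 := rfl

lemma phiIndex_ne {i : Fin 5} (hi : i ≠ 4) : σ i ≠ 4 := by
  revert i; decide

@[simp] lemma phiSign_phiIndex (i : Fin 5) : s (σ i) = -s i := by
  fin_cases i <;> simp [phiSign, phiIndex]

lemma phiSign_sq {i : Fin 5} (hi : i ≠ 4) : s i * s i = 1 := by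
  fin_cases i <;> simp [phiSign] at hi ⊢

/-- `A` is `φ`-invariant on the horizontal space `e_4^⊥`: `A(φ e_i, φ e_j) = A(e_i, e_j)`. -/
def PhiInvariant (A : Mat) : Prop :=
  ∀ i j, i ≠ 4 → j ≠ 4 → s i * s j * A (σ i) (σ j) = A i j

lemma PhiInvariant.swap {A : Mat} (h : PhiInvariant A) {i j : Fin 5} (hi : i ≠ 4) (hj : j ≠ 4) :
    s i * A (σ i) j = -(s j * A i (σ j)) := by
  have h1 := h (σ i) j (phiIndex_ne hi) hj
  rw [phiSign_phiIndex, phiIndex_phiIndex] at h1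
  linear_combination -s i * h1 - s j * A i (σ j) * phiSign_sq hi

/-- Both sides say that the horizontal part of `A` has no `Λ²_2`-part. -/
lemma phiInvariant_iff {A : Mat} (hA : ∀ i j, i ≠ 4 → j ≠ 4 → A i j = -A j i) :
    PhiInvariant A ↔ PerpL2 A := by
  have h00 := hA 0 0 (by decide) (by decide)
  have h11 := hA 1 1 (by decide) (by decide)
  have h22 := hA 2 2 (by decide) (by decide)
  have h33 := hA 3 3 (by decide) (by decide)
  have h10 := hA 1 0 (by decide) (by decide)
  have h20 := hA 2 0 (by decide) (by decide)
  have h30 := hA 3 0 (by decide) (by decide)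
  have h21 := hA 2 1 (by decide) (by decide)
  have h31 := hA 3 1 (by decide) (by decide)
  have h32 := hA 3 2 (by decide) (by decide)
  constructor
  · intro h
    have h1 := h 0 2 (by decide) (by decide)
    have h2 := h 0 3 (by decide) (by decide)
    simp [phiSign, phiIndex] at h1 h2
    exact ⟨by linarith, by linarith⟩
  · rintro ⟨h1, h2⟩ i j hi hj
    fin_cases i <;> fin_cases j <;>
      first
      | exact absurd rfl hi
      | exact absurd rfl hj
      | (simp [phiSign, phiIndex]; linarith)

lemma phiInvariant_iff_of_mem {A : Mat} (hA : A ∈ so5) : PhiInvariant A ↔ PerpL2 A :=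
  phiInvariant_iff fun i j _ _ => mem_so5_iff.1 hA i j

lemma nijComp_swap (w : Ten3) (k i j : Fin 5) : nijComp w k j i = -nijComp w k i j := by
  simp only [nijComp, structConst]; ring

lemma dPhiComp_rotate (w : Ten3) (i j k : Fin 5) : dPhiComp w j k i = dPhiComp w i j k := by
  simp only [dPhiComp, structConst]; ring

lemma nijComp_eq_zero {w : Ten3}
    (h : ∀ k, k ≠ 4 → PhiInvariant (w k)) {k i j : Fin 5} (hk : k ≠ 4) (hi : i ≠ 4) (hj : j ≠ 4) :
    nijComp w k i j = 0 := by
  have e1 := h i hi j k hj hk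
  have e2 := h j hj i k hi hk
  have e3 := (h (σ i) (phiIndex_ne hi)).swap hj hk
  have e4 := (h (σ j) (phiIndex_ne hj)).swap hi hk
  simp only [nijComp, structConst]
  linear_combination e1 - e2 + s i * e3 - s j * e4

lemma dPhiComp_eq_zero {w : Ten3} (hw : ∀ k, w k ∈ so5)
    (h : ∀ k, k ≠ 4 → PhiInvariant (w k)) {i j k : Fin 5} (hi : i ≠ 4) (hj : j ≠ 4) (hk : k ≠ 4) :
    dPhiComp w i j k = 0 := by
  have hs (k : Fin 5) := mem_so5_iff.1 (hw k)
  have e1 := (h i hi).swap hj hk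
  have e2 := (h j hj).swap hi hk
  have e3 := (h k hk).swap hi hj
  rw [hs] at e1 e2 e3
  simp only [dPhiComp, structConst]
  linear_combination -e1 + e2 - e3

/-- The linear algebra of almost Hermitian geometry in dimension four: the horizontal parts of `N`
and `dΦ` vanish if and only if the horizontal part of `∇φ` does. -/
lemma nij_dPhi_horizontal_iff {w : Ten3} (hw : ∀ k, w k ∈ so5) :
    (∀ k i j, k ≠ 4 → i ≠ 4 → j ≠ 4 → nijComp w k i j = 0 ∧ dPhiComp w k i j = 0) ↔
      ∀ k, k ≠ 4 → PerpL2 (w k) := by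
  have hs (k : Fin 5) := mem_so5_iff.1 (hw k)
  constructor
  · intro h
    have hd (k i : Fin 5) : w k i i = 0 := by linarith [hs k i i]
    -- these eight components span all the horizontal ones
    have n1 := (h 0 0 2 (by decide) (by decide) (by decide)).1
    have n2 := (h 0 0 3 (by decide) (by decide) (by decide)).1
    have n3 := (h 2 0 2 (by decide) (by decide) (by decide)).1
    have n4 := (h 2 0 3 (by decide) (by decide) (by decide)).1
    have d1 := (h 0 1 2 (by decide) (by decide) (by decide)).2
    have d2 := (h 0 1 3 (by decide) (by decide) (by decide)).2
    have d3 := (h 1 2 3 (by decide) (by decide) (by decide)).2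
    have d4 := (h 0 2 3 (by decide) (by decide) (by decide)).2
    have s10 (k : Fin 5) := hs k 1 0
    have s20 (k : Fin 5) := hs k 2 0
    have s30 (k : Fin 5) := hs k 3 0
    have s21 (k : Fin 5) := hs k 2 1
    have s31 (k : Fin 5) := hs k 3 1
    have s32 (k : Fin 5) := hs k 3 2
    simp only [nijComp, dPhiComp, structConst, phiSign, phiIndex, hd, s10, s20, s30, s21, s31, s32,
      Matrix.cons_val] at n1 n2 n3 n4 d1 d2 d3 d4
    have p0 : PerpL2 (w 0) := by constructor <;> linarith
    have p1 : PerpL2 (w 1) := by constructor <;> linarith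
    have p2 : PerpL2 (w 2) := by constructor <;> linarith
    have p3 : PerpL2 (w 3) := by constructor <;> linarith
    intro k hk
    fin_cases k
    exacts [p0, p1, p2, p3, absurd rfl hk]
  · intro h
    have h' (k : Fin 5) (hk : k ≠ 4) := (phiInvariant_iff_of_mem (hw k)).2 (h k hk)
    exact fun k i j hk hi hj => ⟨nijComp_eq_zero h' hk hi hj, dPhiComp_eq_zero hw h' hk hi hj⟩

/-- The equations of generalized quasi-Sasaki structures; `ξ` is Killing if and only if `∇ξ`, with
components `w k 4 i`, is skew. -/
theorem nij_dPhi_killing_iff {w : Ten3} (hw : ∀ k, w k ∈ so5) :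
    ((∀ k i j, k ≠ 4 → i ≠ 4 → j ≠ 4 → nijComp w k i j = 0 ∧ dPhiComp w k i j = 0) ∧
        ∀ i j, structConst w 4 i j + structConst w 4 j i = 0) ↔
      (∀ k, k ≠ 4 → PerpL2 (w k)) ∧ ∀ k i, w k 4 i = -w i 4 k := by
  rw [nij_dPhi_horizontal_iff hw]
  refine and_congr_right fun _ => forall₂_congr fun i j => ?_
  simp only [structConst]
  rw [mem_so5_iff.1 (hw 4) i j]
  constructor <;> intro h <;> linarith

/-- The equations of quasi-Sasaki structures: `ξ` is Killing, and `∇ξ` and all `w k` have no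
`Λ²_2`-part. -/
theorem nij_dPhi_iff {w : Ten3} (hw : ∀ k, w k ∈ so5) :
    (∀ k i j, nijComp w k i j = 0 ∧ dPhiComp w k i j = 0) ↔
      (∀ k, PerpL2 (w k)) ∧ (∀ k i, w k 4 i = -w i 4 k) ∧ PerpL2 fun k => w k 4 := by
  have hs (k : Fin 5) := mem_so5_iff.1 (hw k)
  have h44 (k : Fin 5) : w k 4 4 = 0 := by linarith [hs k 4 4]
  constructor
  · intro h
    have hor := (nij_dPhi_horizontal_iff hw).1 fun k i j _ _ _ => h k i j
    have hA4 (j : Fin 5) : w 4 4 j = 0 := by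
      have := (h 4 4 j).1
      simp [nijComp, structConst, h44] at this
      rw [hs, this, neg_zero]
    -- `B i j = A i j - A j i` for `A i j = w i 4 j` is `φ`-invariant because `N(e_4, ·, ·) = 0`
    have hB (i j : Fin 5) (hi : i ≠ 4) (hj : j ≠ 4) :
        s i * s j * (w (σ i) 4 (σ j) - w (σ j) 4 (σ i)) = w i 4 j - w j 4 i := by
      have := (h 4 i j).1
      simp only [nijComp, structConst, phiSign_four, phiIndex_four] at this
      rw [hs i j 4, hs j i 4, hs _ _ 4, hs _ _ 4] at this
      linear_combination -this
    -- `N(e_k, e_4, e_j) = 0` compares the `φ`-anti-invariant parts of `A` and of `w 4`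
    have hD (j k : Fin 5) : w j 4 k - s j * s k * w (σ j) 4 (σ k)
        = w 4 j k - s j * s k * w 4 (σ j) (σ k) := by
      have := (h k 4 j).1
      simp only [nijComp, structConst, phiSign_four, phiIndex_four] at this
      linear_combination this
    have hw4 : PhiInvariant (w 4) := by
      intro i j hi hj
      have e1 := hD i j
      have e2 := hD j i
      rw [hs 4 j i, hs 4 (σ j)] at e2
      linear_combination (e1 - e2 + hB i j hi hj) / 2
    have hA : PhiInvariant fun k => w k 4 := by
      intro i j hi hj
      linear_combination hw4 i j hi hj - hD i j
    have hK (k i : Fin 5) : w k 4 i = -w i 4 k := by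
      by_cases hk : k = 4
      · rw [hk, hA4, h44, neg_zero]
      by_cases hi : i = 4
      · rw [hi, hA4, h44, neg_zero]
      -- `dΦ(e_i, φ e_k, ξ) = 0`, once `A` and `w 4` are `φ`-invariant, is the skewness of `A`
      have hd := (h i (σ k) 4).2
      simp only [dPhiComp, structConst, phiSign_four, phiSign_phiIndex, phiIndex_phiIndex] at hd
      linear_combination -s k * hd - (w i 4 k - w 4 i k) * phiSign_sq hk - hA k i hk hi
        + hw4 k i hk hi + hs 4 k i
    refine ⟨fun k => ?_, hK, (phiInvariant_iff fun i j _ _ => hK i j).1 hA⟩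
    by_cases hk : k = 4
    · rw [hk]
      exact (phiInvariant_iff_of_mem (hw 4)).1 hw4
    · exact hor k hk
  · rintro ⟨hP, hK, hA⟩
    have hI (k : Fin 5) := (phiInvariant_iff_of_mem (hw k)).2 (hP k)
    have hA : PhiInvariant fun k => w k 4 := (phiInvariant_iff fun i j _ _ => hK i j).2 hA
    have hA4 (j : Fin 5) : w 4 4 j = 0 := by rw [hK, h44, neg_zero]
    have hN4 (k j : Fin 5) : nijComp w k 4 j = 0 := by
      simp only [nijComp, structConst, phiSign_four, phiIndex_four]
      by_cases hj : j = 4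
      · rw [hj]; simp
      by_cases hk : k = 4
      · rw [hk]; simp [h44, hs 4 j 4, hA4]
      linear_combination hI 4 j k hj hk - hA j k hj hk
    have hD4 (i j : Fin 5) : dPhiComp w i j 4 = 0 := by
      simp only [dPhiComp, structConst, phiSign_four, phiIndex_four]
      by_cases hi : i = 4
      · rw [hi]; simp
      by_cases hj : j = 4
      · rw [hj]; simp
      have e1 := (hI 4).swap hi hj
      have e2 : s i * w (σ i) 4 j = -(s j * w i 4 (σ j)) := hA.swap hi hj
      rw [hs] at e1
      rw [hK] at e2
      linear_combination e2 - e1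
    refine fun k i j => ⟨?_, ?_⟩
    · by_cases hi : i = 4
      · rw [hi, hN4]
      by_cases hj : j = 4
      · rw [hj, nijComp_swap, hN4, neg_zero]
      by_cases hk : k = 4
      · have hA' : s i * s j * w (σ i) 4 (σ j) = w i 4 j := hA i j hi hj
        simp only [hk, nijComp, structConst, phiSign_four, phiIndex_four]
        rw [hs i j, hs j i, hs (σ i), hs (σ j), hK j i, hK (σ j)]
        linear_combination -2 * hA'
      exact nijComp_eq_zero (fun k _ => hI k) hk hi hj
    · by_cases hk : k = 4
      · rw [hk, ← dPhiComp_rotate, hD4]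
      by_cases hi : i = 4
      · rw [hi, ← dPhiComp_rotate, ← dPhiComp_rotate, hD4]
      by_cases hj : j = 4
      · rw [hj, hD4]
      exact dPhiComp_eq_zero hw (fun k _ => hI k) hk hi hj

/-! ### Tensoriality of `N`, `dΦ` and `L_ξ g` -/

section Tensoriality

variable {M : Type*} [TopologicalSpace M] [ChartedSpace E5 M] [IsManifold (𝓡 5) ∞ M]

/-- The vector field `X` is differentiable at the point `x`. -/
def DiffAt (X : VF M) (x : M) : Prop :=
  MDifferentiableAt (𝓡 5) (𝓡 5).tangent (fun y => (⟨y, X y⟩ : TangentBundle (𝓡 5) M)) x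

lemma SmoothAt.diffAt {X : VF M} {x : M} (h : SmoothAt X x) : DiffAt X x :=
  h.mdifferentiableAt (by simp)

lemma DiffAt.smul {f : M → ℝ} {X : VF M} {x : M} (hf : MDifferentiableAt (𝓡 5) 𝓘(ℝ) f x)
    (h : DiffAt X x) : DiffAt (f • X) x :=
  hf.smul_section h

lemma DiffAt.add {X Y : VF M} {x : M} (h : DiffAt X x) (h' : DiffAt Y x) : DiffAt (X + Y) x :=
  mdifferentiableAt_add_section h h'

lemma br_swap (X Y : VF M) (x : M) : br X Y x = -br Y X x :=
  VectorField.mlieBracket_swap_apply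

lemma br_smul_left {f : M → ℝ} {X : VF M} {x : M} (hf : MDifferentiableAt (𝓡 5) 𝓘(ℝ) f x)
    (hX : DiffAt X x) (Y : VF M) : br (f • X) Y x = -(der Y f x • X x) + f x • br X Y x := by
  have := VectorField.mlieBracket_smul_left (W := Y) hf hX
  rw [neg_smul] at this
  exact this

lemma br_smul_right {f : M → ℝ} {Y : VF M} {x : M} (hf : MDifferentiableAt (𝓡 5) 𝓘(ℝ) f x)
    (hY : DiffAt Y x) (X : VF M) : br X (f • Y) x = der X f x • Y x + f x • br X Y x :=
  VectorField.mlieBracket_smul_right hf hY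

lemma br_add_left {X X' : VF M} {x : M} (hX : DiffAt X x) (hX' : DiffAt X' x) (Y : VF M) :
    br (X + X') Y x = br X Y x + br X' Y x :=
  VectorField.mlieBracket_add_left hX hX'

lemma der_mul (X : VF M) {f h : M → ℝ} {x : M} (hf : MDifferentiableAt (𝓡 5) 𝓘(ℝ) f x)
    (hh : MDifferentiableAt (𝓡 5) 𝓘(ℝ) h x) :
    der X (f * h) x = f x * der X h x + h x * der X f x := by
  rw [der, mvfderiv_mul hf hh]
  simp [der]

lemma der_add (X : VF M) {f h : M → ℝ} {x : M} (hf : MDifferentiableAt (𝓡 5) 𝓘(ℝ) f x)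
    (hh : MDifferentiableAt (𝓡 5) 𝓘(ℝ) h x) :
    der X (f + h) x = der X f x + der X h x := by
  rw [der, mvfderiv_add hf hh]
  rfl

lemma der_neg (X : VF M) (f : M → ℝ) (x : M) : der X (-f) x = -der X f x := by
  rw [der, mvfderiv_neg]
  rfl

lemma der_smul_left (X : VF M) (f h : M → ℝ) (x : M) : der (f • X) h x = f x * der X h x := by
  simp [der]

lemma der_add_left (X Y : VF M) (h : M → ℝ) (x : M) :
    der (X + Y) h x = der X h x + der Y h x := by
  simp [der]

variable [RiemannianBundle (fun x : M => TangentSpace (𝓡 5) x)]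

lemma g_comm (X Y : VF M) : g X Y = g Y X := funext fun x => real_inner_comm (Y x) (X x)

lemma g_smul_left (f : M → ℝ) (X Y : VF M) : g (f • X) Y = f * g X Y :=
  funext fun x => real_inner_smul_left (X x) (Y x) (f x)

lemma g_add_left (X X' Y : VF M) : g (X + X') Y = g X Y + g X' Y :=
  funext fun x => inner_add_left (X x) (X' x) (Y x)

set_option synthInstance.maxHeartbeats 200000 in
lemma DiffAt.g [IsContMDiffRiemannianBundle (𝓡 5) ∞ E5 (fun x : M => TangentSpace (𝓡 5) x)]
    {X Y : VF M} {x : M} (hX : DiffAt X x) (hY : DiffAt Y x) :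
    MDifferentiableAt (𝓡 5) 𝓘(ℝ) (g X Y) x :=
  MDifferentiableAt.inner_bundle hX hY

/-- A tensorial operation that vanishes on the fields `e i` vanishes on every field whose value at
`x` lies in their span. -/
lemma _root_.TensorialAt.eq_zero_of_sum {x : M} {T : VF M → ℝ} (hT : TensorialAt (𝓡 5) E5 T x)
    {ι : Type*} {t : Finset ι} {e : ι → VF M} (he : ∀ i, DiffAt (e i) x) {X : VF M}
    (hX : DiffAt X x) {c : ι → ℝ} (hc : X x = ∑ i ∈ t, c i • e i x) (h : ∀ i ∈ t, T (e i) = 0) :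
    T X = 0 := by
  have hconst (i : ι) : MDifferentiableAt (𝓡 5) 𝓘(ℝ) (fun _ : M => c i) x :=
    mdifferentiableAt_const
  have hd (i : ι) : DiffAt ((fun _ : M => c i) • e i) x := (he i).smul (hconst i)
  have hsum : DiffAt (fun y => ∑ i ∈ t, ((fun _ : M => c i) • e i) y) x :=
    MDifferentiableAt.sum_section fun i _ => hd i
  rw [hT.pointwise hX hsum hc, hT.sum _ fun i _ => hd i]
  exact Finset.sum_eq_zero fun i hi => by rw [hT.smul (hconst i) (he i), h i hi, smul_zero]

end Tensoriality

namespace AlmostContact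

variable {M : Type*} [TopologicalSpace M] [ChartedSpace E5 M] [IsManifold (𝓡 5) ∞ M]
  [RiemannianBundle (fun x : M => TangentSpace (𝓡 5) x)] (S : AlmostContact M)

lemma ap_smul (f : M → ℝ) (X : VF M) : S.ap (f • X) = f • S.ap X :=
  funext fun x => (S.φ x).map_smul (f x) (X x)

lemma ap_add (X Y : VF M) : S.ap (X + Y) = S.ap X + S.ap Y :=
  funext fun x => (S.φ x).map_add (X x) (Y x)

lemma diffAt_ξ (x : M) : DiffAt S.ξ x := (S.smooth_ξ x).mdifferentiableAt (by simp)

lemma smoothOn_ap {X : VF M} {U : Set M} (hX : SmoothOn X U) : SmoothOn (S.ap X) U :=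
  ContMDiffOn.clm_bundle_apply (b := fun y => y) S.smooth_φ.contMDiffOn hX

lemma diffAt_ap {X : VF M} {x : M} (hX : DiffAt X x) : DiffAt (S.ap X) x :=
  MDifferentiableAt.clm_bundle_apply (b := fun y => y)
    ((S.smooth_φ x).mdifferentiableAt (by simp)) hX

lemma eta_eq (X : VF M) : S.eta X = g X S.ξ := g_comm _ _

lemma inner_ξ_φ (x : M) (v : TangentSpace (𝓡 5) x) : inner ℝ (S.ξ x) (S.φ x v) = 0 := by
  have h1 := S.φ_sq x (S.φ x v)
  rw [S.φ_sq x v, map_add, map_smul, S.φ_ξ, smul_zero, add_zero, map_neg, left_eq_add] at h1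
  have h2 := congrArg (inner ℝ (S.ξ x)) h1
  rwa [inner_smul_right, S.norm_ξ, mul_one, inner_zero_right] at h2

/-- `φ` is skew-symmetric, as it preserves the metric on the horizontal space. -/
lemma inner_φ_right (x : M) (v w : TangentSpace (𝓡 5) x) :
    inner ℝ v (S.φ x w) = -inner ℝ (S.φ x v) w := by
  have h := S.inner_φ x (S.φ x v) w
  rw [S.inner_ξ_φ, zero_mul, sub_zero, S.φ_sq, inner_add_left, inner_neg_left,
    real_inner_smul_left, S.inner_ξ_φ, mul_zero, add_zero] at h
  linarith

lemma Phi_swap (X Y : VF M) : S.Phi X Y = -S.Phi Y X := funext fun x => by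
  change inner ℝ (X x) (S.φ x (Y x)) = -inner ℝ (Y x) (S.φ x (X x))
  rw [S.inner_φ_right, real_inner_comm]

lemma Phi_smul_left (f : M → ℝ) (X Y : VF M) : S.Phi (f • X) Y = f * S.Phi X Y :=
  g_smul_left f X (S.ap Y)

lemma Phi_add_left (X X' Y : VF M) : S.Phi (X + X') Y = S.Phi X Y + S.Phi X' Y :=
  g_add_left X X' (S.ap Y)

lemma eta_smul (f : M → ℝ) (X : VF M) : S.eta (f • X) = f * S.eta X := by
  rw [eta_eq, eta_eq, g_smul_left]

lemma eta_add (X Y : VF M) : S.eta (X + Y) = S.eta X + S.eta Y := by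
  rw [eta_eq, eta_eq, eta_eq, g_add_left]

lemma nijTorsion_swap (X Y : VF M) (x : M) : S.nijTorsion Y X x = -S.nijTorsion X Y x := by
  simp only [nijTorsion, Pi.add_apply, Pi.sub_apply, ap]
  rw [br_swap (S.ap Y), br_swap Y X, br_swap (S.ap Y) X, br_swap Y (S.ap X)]
  simp only [map_neg]
  abel

lemma dEta_swap (X Y : VF M) (x : M) : S.dEta Y X x = -S.dEta X Y x := by
  have h : S.eta (br Y X) x = -S.eta (br X Y) x := by
    simp only [eta]
    rw [br_swap, inner_neg_right]
  rw [dEta, dEta, h]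
  ring

lemma nijenhuis_swap (X Y Z : VF M) (x : M) : S.nijenhuis X Z Y x = -S.nijenhuis X Y Z x := by
  simp only [nijenhuis, g]
  rw [nijTorsion_swap, dEta_swap, inner_neg_right]
  ring

lemma Phi_br_swap (X Y Z : VF M) (x : M) : S.Phi (br Y X) Z x = -S.Phi (br X Y) Z x := by
  simp only [Phi, g]
  rw [br_swap, inner_neg_left]

lemma dPhi_rotate (X Y Z : VF M) (x : M) : S.dPhi Y Z X x = S.dPhi X Y Z x := by
  rw [dPhi, dPhi, S.Phi_br_swap X Y, S.Phi_br_swap X Z, S.Phi_swap Z X, S.Phi_swap Y X, der_neg,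
    der_neg]
  ring

lemma tensorialAt_nijenhuis_left (Y Z : VF M) (x : M) :
    TensorialAt (𝓡 5) E5 (fun X => S.nijenhuis X Y Z x) x where
  smul {f X} _ _ := by
    simp only [nijenhuis, g_smul_left, eta_smul, Pi.mul_apply, smul_eq_mul]
    ring
  add {X X'} _ _ := by
    simp only [nijenhuis, g_add_left, eta_add, Pi.add_apply]
    ring

variable [IsContMDiffRiemannianBundle (𝓡 5) ∞ E5 (fun x : M => TangentSpace (𝓡 5) x)]

lemma mdifferentiableAt_eta {X : VF M} {x : M} (hX : DiffAt X x) :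
    MDifferentiableAt (𝓡 5) 𝓘(ℝ) (S.eta X) x :=
  (S.diffAt_ξ x).g hX

lemma mdifferentiableAt_Phi {X Y : VF M} {x : M} (hX : DiffAt X x) (hY : DiffAt Y x) :
    MDifferentiableAt (𝓡 5) 𝓘(ℝ) (S.Phi X Y) x :=
  hX.g (S.diffAt_ap hY)

/-- The derivatives of the coefficient cancel, since `[φ(f Y), φ Z]` and `φ[f Y, φ Z]` contribute
`(φ Z)(f) φ Y`, and `φ²[f Y, Z]` and `φ[φ (f Y), Z]` contribute `Z(f) φ² Y`. -/
lemma nijTorsion_smul {f : M → ℝ} {Y : VF M} (Z : VF M) {x : M}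
    (hf : MDifferentiableAt (𝓡 5) 𝓘(ℝ) f x) (hY : DiffAt Y x) :
    S.nijTorsion (f • Y) Z x = f x • S.nijTorsion Y Z x := by
  simp only [nijTorsion, Pi.add_apply, Pi.sub_apply, ap_smul]
  rw [br_smul_left hf (S.diffAt_ap hY)]
  simp only [ap]
  rw [br_smul_left hf hY, br_smul_left hf hY]
  have := br_smul_left hf (S.diffAt_ap hY) Z
  simp only [ap] at this
  rw [this]
  simp only [map_add, map_neg, map_smul]
  module

lemma nijTorsion_add {Y Y' : VF M} (Z : VF M) {x : M} (hY : DiffAt Y x) (hY' : DiffAt Y' x) :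
    S.nijTorsion (Y + Y') Z x = S.nijTorsion Y Z x + S.nijTorsion Y' Z x := by
  simp only [nijTorsion, Pi.add_apply, Pi.sub_apply, ap_add]
  rw [br_add_left (S.diffAt_ap hY) (S.diffAt_ap hY')]
  have := br_add_left (S.diffAt_ap hY) (S.diffAt_ap hY') Z
  simp only [ap] at this ⊢
  rw [br_add_left hY hY', br_add_left hY hY', this]
  simp only [map_add]
  abel

lemma tensorialAt_dEta (Z : VF M) (x : M) :
    TensorialAt (𝓡 5) E5 (fun Y => S.dEta Y Z x) x where
  smul {f Y} hf hY := by
    have h : S.eta (br (f • Y) Z) x = -(der Z f x * S.eta Y x) + f x * S.eta (br Y Z) x := by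
      simp only [eta]
      rw [br_smul_left hf hY, inner_add_right, inner_neg_right, inner_smul_right, inner_smul_right]
    simp only [dEta]
    rw [h, der_smul_left, eta_smul, der_mul Z hf (S.mdifferentiableAt_eta hY), smul_eq_mul]
    ring
  add {Y Y'} hY hY' := by
    have h : S.eta (br (Y + Y') Z) x = S.eta (br Y Z) x + S.eta (br Y' Z) x := by
      simp only [eta]
      rw [br_add_left hY hY', inner_add_right]
    simp only [dEta]
    rw [h, der_add_left, eta_add, der_add Z (S.mdifferentiableAt_eta hY)
      (S.mdifferentiableAt_eta hY')]
    ring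

lemma tensorialAt_nijenhuis_middle (X Z : VF M) (x : M) :
    TensorialAt (𝓡 5) E5 (fun Y => S.nijenhuis X Y Z x) x where
  smul {f Y} hf hY := by
    have h := (S.tensorialAt_dEta Z x).smul hf hY
    simp only [smul_eq_mul] at h
    simp only [nijenhuis, g]
    rw [S.nijTorsion_smul Z hf hY, inner_smul_right, h, smul_eq_mul]
    ring
  add {Y Y'} hY hY' := by
    have h := (S.tensorialAt_dEta Z x).add hY hY'
    simp only [nijenhuis, g]
    rw [S.nijTorsion_add Z hY hY', inner_add_right, h]
    ring

lemma tensorialAt_dPhi {Y Z : VF M} {x : M} (hY : DiffAt Y x) (hZ : DiffAt Z x) :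
    TensorialAt (𝓡 5) E5 (fun X => S.dPhi X Y Z x) x where
  smul {f X} hf hX := by
    have h (V W : VF M) : S.Phi (br (f • X) V) W x
        = -(der V f x * S.Phi X W x) + f x * S.Phi (br X V) W x := by
      simp only [Phi, g]
      rw [br_smul_left hf hX, inner_add_left, inner_neg_left, real_inner_smul_left,
        real_inner_smul_left]
    simp only [dPhi]
    rw [h, h, der_smul_left, Phi_smul_left, Phi_smul_left, S.Phi_swap (br Y Z), Phi_smul_left,
      der_mul Y hf (S.mdifferentiableAt_Phi hX hZ), der_mul Z hf (S.mdifferentiableAt_Phi hX hY),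
      S.Phi_swap (br Y Z)]
    simp only [Pi.neg_apply, Pi.mul_apply, smul_eq_mul]
    ring
  add {X X'} hX hX' := by
    have h (V W : VF M) : S.Phi (br (X + X') V) W x
        = S.Phi (br X V) W x + S.Phi (br X' V) W x := by
      simp only [Phi, g]
      rw [br_add_left hX hX', inner_add_left]
    simp only [dPhi]
    rw [h, h, der_add_left, Phi_add_left, Phi_add_left, S.Phi_swap (br Y Z), Phi_add_left,
      der_add Y (S.mdifferentiableAt_Phi hX hZ) (S.mdifferentiableAt_Phi hX' hZ),
      der_add Z (S.mdifferentiableAt_Phi hX hY) (S.mdifferentiableAt_Phi hX' hY),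
      S.Phi_swap (br Y Z) X, S.Phi_swap (br Y Z) X']
    simp only [Pi.neg_apply, Pi.add_apply]
    ring

end AlmostContact

section LieDerivative

variable {M : Type*} [TopologicalSpace M] [ChartedSpace E5 M] [IsManifold (𝓡 5) ∞ M]
  [RiemannianBundle (fun x : M => TangentSpace (𝓡 5) x)]

/-- The Lie derivative `(L_V g)(X, Y)` of the metric. -/
def lieMetric (V X Y : VF M) (x : M) : ℝ :=
  der V (g X Y) x - g (br V X) Y x - g X (br V Y) x

lemma lieMetric_comm (V X Y : VF M) (x : M) : lieMetric V X Y x = lieMetric V Y X x := by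
  rw [lieMetric, lieMetric, g_comm X Y, g_comm (br V X), g_comm X]
  ring

variable [IsContMDiffRiemannianBundle (𝓡 5) ∞ E5 (fun x : M => TangentSpace (𝓡 5) x)]

lemma tensorialAt_lieMetric (V : VF M) {Y : VF M} {x : M} (hY : DiffAt Y x) :
    TensorialAt (𝓡 5) E5 (fun X => lieMetric V X Y x) x where
  smul {f X} hf hX := by
    have h : g (br V (f • X)) Y x = der V f x * g X Y x + f x * g (br V X) Y x := by
      simp only [g]
      rw [br_smul_right hf hX, inner_add_left, real_inner_smul_left, real_inner_smul_left]
    have hX' : DiffAt X x := hX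
    simp only [lieMetric]
    rw [h, g_smul_left, g_smul_left, der_mul V hf (hX'.g hY)]
    simp only [Pi.mul_apply, smul_eq_mul]
    ring
  add {X X'} hX hX' := by
    have h : g (br V (X + X')) Y x = g (br V X) Y x + g (br V X') Y x := by
      simp only [g]
      rw [br_swap, br_add_left hX hX', neg_add, ← br_swap, ← br_swap, inner_add_left]
    have h1 : DiffAt X x := hX
    have h2 : DiffAt X' x := hX'
    simp only [lieMetric]
    rw [h, g_add_left, g_add_left, der_add V (h1.g hY) (h2.g hY)]
    simp only [Pi.add_apply]
    ring

end LieDerivative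

/-! ### Computations in an adapted frame -/

section Local

variable {M : Type*} [TopologicalSpace M] [ChartedSpace E5 M] [IsManifold (𝓡 5) ∞ M]

lemma der_eq_zero_of_eventually_const (X : VF M) {f : M → ℝ} {c : ℝ} {x : M}
    (h : ∀ᶠ y in nhds x, f y = c) : der X f x = 0 := by
  have h' : f =ᶠ[nhds x] fun _ => c := h
  change (mfderiv (𝓡 5) 𝓘(ℝ) f x (X x) : ℝ) = 0
  rw [h'.mfderiv_eq, mfderiv_const]
  rfl

lemma br_congr {X X' Y Y' : VF M} {x : M} (hX : ∀ᶠ y in nhds x, X y = X' y)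
    (hY : ∀ᶠ y in nhds x, Y y = Y' y) : br X Y x = br X' Y' x :=
  Filter.EventuallyEq.mlieBracket_vectorField_eq hX hY

lemma br_const_smul_left (c : ℝ) {X : VF M} {x : M} (hX : DiffAt X x) (Y : VF M) :
    br (c • X) Y x = c • br X Y x :=
  VectorField.mlieBracket_const_smul_left hX

lemma br_const_smul_right (c : ℝ) {Y : VF M} {x : M} (hY : DiffAt Y x) (X : VF M) :
    br X (c • Y) x = c • br X Y x :=
  VectorField.mlieBracket_const_smul_right hY

lemma SmoothOn.smoothAt {X : VF M} {U : Set M} {x : M} (h : SmoothOn X U) (hU : IsOpen U)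
    (hx : x ∈ U) : SmoothAt X x :=
  (h x hx).contMDiffAt (hU.mem_nhds hx)

variable [RiemannianBundle (fun x : M => TangentSpace (𝓡 5) x)]

/-- The Koszul formula defines a torsion-free connection. -/
lemma nablaInner_sub_nablaInner (X Y Z : VF M) (x : M) :
    nablaInner X Y Z x - nablaInner Y X Z x = g (br X Y) Z x := by
  have h : g (br Y X) Z x = -g (br X Y) Z x := by
    simp only [g]
    rw [br_swap, inner_neg_left]
  rw [nablaInner, nablaInner, h, g_comm Y X]
  ring

/-- The Koszul formula defines a metric connection. -/
lemma nablaInner_add_nablaInner (X Y Z : VF M) (x : M) :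
    nablaInner X Y Z x + nablaInner X Z Y x = der X (g Y Z) x := by
  have h : g (br Z Y) X x = -g (br Y Z) X x := by
    simp only [g]
    rw [br_swap, inner_neg_left]
  rw [nablaInner, nablaInner, h, g_comm Z Y]
  ring

lemma sum_inner_smul_eq {x : M} {b : Fin 5 → TangentSpace (𝓡 5) x} (hb : Orthonormal ℝ b)
    (v : TangentSpace (𝓡 5) x) : ∑ i, inner ℝ (b i) v • b i = v := by
  have hfin : Module.finrank ℝ (TangentSpace (𝓡 5) x) = 5 := finrank_euclideanSpace_fin
  have : FiniteDimensional ℝ (TangentSpace (𝓡 5) x) := .of_finrank_pos (by omega)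
  have hsp : ⊤ ≤ Submodule.span ℝ (Set.range b) :=
    (hb.linearIndependent.span_eq_top_of_card_eq_finrank (by simp [hfin])).ge
  have h := (OrthonormalBasis.mk hb hsp).sum_repr' v
  simpa using h

end Local

namespace AlmostContact.IsAdaptedFrame

variable {M : Type*} [TopologicalSpace M] [ChartedSpace E5 M] [IsManifold (𝓡 5) ∞ M]
  [RiemannianBundle (fun x : M => TangentSpace (𝓡 5) x)] {S : AlmostContact M}
  {e : Fin 5 → VF M} {U : Set M}

lemma smoothAt (h : S.IsAdaptedFrame e U) {x : M} (hx : x ∈ U) (i : Fin 5) : SmoothAt (e i) x :=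
  (h.smooth i).smoothAt h.isOpen hx

lemma diffAt (h : S.IsAdaptedFrame e U) {x : M} (hx : x ∈ U) (i : Fin 5) : DiffAt (e i) x :=
  (h.smoothAt hx i).diffAt

lemma inner_eq (h : S.IsAdaptedFrame e U) {x : M} (hx : x ∈ U) (i j : Fin 5) :
    inner ℝ (e i x) (e j x) = if i = j then (1 : ℝ) else 0 :=
  orthonormal_iff_ite.1 (h.orthonormal x hx) i j

lemma ap_eq (h : S.IsAdaptedFrame e U) {x : M} (hx : x ∈ U) (i : Fin 5) :
    S.φ x (e i x) = s i • e (σ i) x := by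
  have hΦ (j : Fin 5) : inner ℝ (e j x) (S.φ x (e i x)) = Phi0 j i := h.phi x hx j i
  have h1 := sum_inner_smul_eq (h.orthonormal x hx) (S.φ x (e i x))
  simp only [hΦ] at h1
  rw [← h1, Fin.sum_univ_five]
  fin_cases i <;> simp [Phi0, phiSign, phiIndex]

lemma eventually_ap_eq (h : S.IsAdaptedFrame e U) {x : M} (hx : x ∈ U) (i : Fin 5) :
    ∀ᶠ y in nhds x, S.ap (e i) y = (s i • e (σ i)) y := by
  filter_upwards [h.isOpen.mem_nhds hx] with y hy using h.ap_eq hy i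

lemma eventually_ξ_eq (h : S.IsAdaptedFrame e U) {x : M} (hx : x ∈ U) :
    ∀ᶠ y in nhds x, S.ξ y = e 4 y := by
  filter_upwards [h.isOpen.mem_nhds hx] with y hy using (h.xi y hy).symm

lemma der_g (h : S.IsAdaptedFrame e U) {x : M} (hx : x ∈ U) (X : VF M) (i j : Fin 5) :
    der X (g (e i) (e j)) x = 0 := by
  refine der_eq_zero_of_eventually_const X (c := if i = j then 1 else 0) ?_
  filter_upwards [h.isOpen.mem_nhds hx] with y hy using h.inner_eq hy i j

lemma der_eta (h : S.IsAdaptedFrame e U) {x : M} (hx : x ∈ U) (X : VF M) (i : Fin 5) :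
    der X (S.eta (e i)) x = 0 := by
  refine der_eq_zero_of_eventually_const X (c := if 4 = i then 1 else 0) ?_
  filter_upwards [h.isOpen.mem_nhds hx] with y hy
  rw [eta, ← h.xi y hy, h.inner_eq hy]

lemma der_Phi (h : S.IsAdaptedFrame e U) {x : M} (hx : x ∈ U) (X : VF M) (i j : Fin 5) :
    der X (S.Phi (e i) (e j)) x = 0 := by
  refine der_eq_zero_of_eventually_const X (c := Phi0 i j) ?_
  filter_upwards [h.isOpen.mem_nhds hx] with y hy using h.phi y hy i j

lemma connForm_mem_so5 (h : S.IsAdaptedFrame e U) {x : M} (hx : x ∈ U) (k : Fin 5) :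
    connForm e x k ∈ so5 := by
  refine mem_so5_iff.2 fun i j => ?_
  have := nablaInner_add_nablaInner (e k) (e i) (e j) x
  rw [h.der_g hx] at this
  exact eq_neg_of_add_eq_zero_left this

lemma inner_br (e : Fin 5 → VF M) (x : M) (i j k : Fin 5) :
    inner ℝ (br (e i) (e j) x) (e k x) = structConst (connForm e x) i j k :=
  (nablaInner_sub_nablaInner (e i) (e j) (e k) x).symm

lemma inner_φ (h : S.IsAdaptedFrame e U) {x : M} (hx : x ∈ U) (k : Fin 5)
    (v : TangentSpace (𝓡 5) x) :
    inner ℝ (e k x) (S.φ x v) = -(s k * inner ℝ (e (σ k) x) v) := by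
  rw [S.inner_φ_right, h.ap_eq hx, real_inner_smul_left]

lemma nijTorsion_eq (h : S.IsAdaptedFrame e U) {x : M} (hx : x ∈ U) (i j : Fin 5) :
    S.nijTorsion (e i) (e j) x = (s i * s j) • br (e (σ i)) (e (σ j)) x
      + S.φ x (S.φ x (br (e i) (e j) x)) - s i • S.φ x (br (e (σ i)) (e j) x)
      - s j • S.φ x (br (e i) (e (σ j)) x) := by
  have h1 : br (S.ap (e i)) (S.ap (e j)) x = (s i * s j) • br (e (σ i)) (e (σ j)) x := by
    rw [br_congr (h.eventually_ap_eq hx i) (h.eventually_ap_eq hx j),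
      br_const_smul_left _ (h.diffAt hx _), br_const_smul_right _ (h.diffAt hx _), smul_smul]
  have h2 : br (S.ap (e i)) (e j) x = s i • br (e (σ i)) (e j) x := by
    rw [br_congr (h.eventually_ap_eq hx i) (Filter.Eventually.of_forall fun _ => rfl),
      br_const_smul_left _ (h.diffAt hx _)]
  have h3 : br (e i) (S.ap (e j)) x = s j • br (e i) (e (σ j)) x := by
    rw [br_congr (Filter.Eventually.of_forall fun _ => rfl) (h.eventually_ap_eq hx j),
      br_const_smul_right _ (h.diffAt hx _)]
  change br (S.ap (e i)) (S.ap (e j)) x + S.φ x (S.φ x (br (e i) (e j) x))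
    - S.φ x (br (S.ap (e i)) (e j) x) - S.φ x (br (e i) (S.ap (e j)) x) = _
  rw [h1, h2, h3, map_smul, map_smul]

lemma nijenhuis_eq (h : S.IsAdaptedFrame e U) {x : M} (hx : x ∈ U) (k i j : Fin 5) :
    S.nijenhuis (e k) (e i) (e j) x = nijComp (connForm e x) k i j := by
  have hη : S.eta (e k) x = inner ℝ (e k x) (S.ξ x) := real_inner_comm _ _
  have hdη : S.dEta (e i) (e j) x = -inner ℝ (S.ξ x) (br (e i) (e j) x) := by
    rw [dEta, h.der_eta hx, h.der_eta hx, sub_zero, zero_sub]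
    rfl
  rw [nijenhuis, hη, hdη, g, h.nijTorsion_eq hx, S.φ_sq]
  simp only [inner_sub_right, inner_add_right, inner_neg_right, inner_smul_right, h.inner_φ hx]
  simp only [real_inner_comm (br _ _ x) (e _ x), inner_br]
  rw [nijComp]
  ring

lemma dPhi_eq (h : S.IsAdaptedFrame e U) {x : M} (hx : x ∈ U) (i j k : Fin 5) :
    S.dPhi (e i) (e j) (e k) x = dPhiComp (connForm e x) i j k := by
  have hΦ (a b c : Fin 5) :
      S.Phi (br (e a) (e b)) (e c) x = s c * structConst (connForm e x) a b (σ c) := by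
    change inner ℝ (br (e a) (e b) x) (S.φ x (e c x)) = _
    rw [h.ap_eq hx, inner_smul_right, inner_br]
  rw [dPhi, h.der_Phi hx, h.der_Phi hx, h.der_Phi hx, hΦ, hΦ, hΦ, dPhiComp]
  ring

lemma lieMetric_eq (h : S.IsAdaptedFrame e U) {x : M} (hx : x ∈ U) (i j : Fin 5) :
    lieMetric S.ξ (e i) (e j) x
      = -(structConst (connForm e x) 4 i j + structConst (connForm e x) 4 j i) := by
  have hb (a : Fin 5) : br S.ξ (e a) x = br (e 4) (e a) x :=
    br_congr (h.eventually_ξ_eq hx) (Filter.Eventually.of_forall fun _ => rfl)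
  rw [lieMetric, h.der_g hx]
  simp only [g]
  rw [hb, hb, real_inner_comm (br (e 4) (e j) x), inner_br, inner_br]
  ring

lemma eq_sum (h : S.IsAdaptedFrame e U) {x : M} (hx : x ∈ U) (v : TangentSpace (𝓡 5) x) :
    v = ∑ i, (inner ℝ (e i x) v : ℝ) • e i x :=
  (sum_inner_smul_eq (h.orthonormal x hx) v).symm

lemma eq_sum_horizontal (h : S.IsAdaptedFrame e U) {x : M} (hx : x ∈ U)
    {v : TangentSpace (𝓡 5) x} (hv : inner ℝ (S.ξ x) v = (0 : ℝ)) :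
    v = ∑ i ∈ Finset.univ.erase 4, (inner ℝ (e i x) v : ℝ) • e i x := by
  rw [← h.xi x hx] at hv
  conv_lhs => rw [h.eq_sum hx v]
  rw [Finset.sum_erase]
  rw [hv, zero_smul]

variable [IsContMDiffRiemannianBundle (𝓡 5) ∞ E5 (fun x : M => TangentSpace (𝓡 5) x)]

lemma lieMetric_eq_zero_iff (h : S.IsAdaptedFrame e U) {x : M} (hx : x ∈ U) :
    (∀ X Y : VF M, SmoothAt X x → SmoothAt Y x → lieMetric S.ξ X Y x = 0) ↔
      ∀ i j, structConst (connForm e x) 4 i j + structConst (connForm e x) 4 j i = 0 := by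
  refine ⟨fun H i j => ?_, fun H X Y hX hY => ?_⟩
  · have := H (e i) (e j) (h.smoothAt hx i) (h.smoothAt hx j)
    rwa [h.lieMetric_eq hx, neg_eq_zero] at this
  · refine (tensorialAt_lieMetric S.ξ hY.diffAt).eq_zero_of_sum (h.diffAt hx) hX.diffAt
      (h.eq_sum hx (X x)) fun i _ => ?_
    rw [lieMetric_comm]
    refine (tensorialAt_lieMetric S.ξ (h.diffAt hx i)).eq_zero_of_sum (h.diffAt hx) hY.diffAt
      (h.eq_sum hx (Y x)) fun j _ => ?_
    rw [h.lieMetric_eq hx, H, neg_zero]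

/-- If `N` and `dΦ` vanish on the frame vectors with index in `t`, they vanish on their span. -/
lemma nijenhuis_dPhi_eq_zero (h : S.IsAdaptedFrame e U) {x : M} (hx : x ∈ U) {t : Finset (Fin 5)}
    (H : ∀ k ∈ t, ∀ i ∈ t, ∀ j ∈ t, nijComp (connForm e x) k i j = 0 ∧
      dPhiComp (connForm e x) k i j = 0)
    {X Y Z : VF M} (hX : DiffAt X x) (hY : DiffAt Y x) (hZ : DiffAt Z x) {a b c : Fin 5 → ℝ}
    (ha : X x = ∑ i ∈ t, a i • e i x) (hb : Y x = ∑ i ∈ t, b i • e i x)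
    (hc : Z x = ∑ i ∈ t, c i • e i x) :
    S.nijenhuis X Y Z x = 0 ∧ S.dPhi X Y Z x = 0 := by
  have he := h.diffAt hx
  constructor
  · refine (S.tensorialAt_nijenhuis_left Y Z x).eq_zero_of_sum he hX ha fun k hk => ?_
    refine (S.tensorialAt_nijenhuis_middle (e k) Z x).eq_zero_of_sum he hY hb fun i hi => ?_
    rw [nijenhuis_swap, neg_eq_zero]
    refine (S.tensorialAt_nijenhuis_middle (e k) (e i) x).eq_zero_of_sum he hZ hc fun j hj => ?_
    rw [h.nijenhuis_eq hx, (H k hk j hj i hi).1]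
  · refine (S.tensorialAt_dPhi hY hZ).eq_zero_of_sum he hX ha fun k hk => ?_
    rw [← dPhi_rotate]
    refine (S.tensorialAt_dPhi hZ (he k)).eq_zero_of_sum he hY hb fun i hi => ?_
    rw [← dPhi_rotate]
    refine (S.tensorialAt_dPhi (he k) (he i)).eq_zero_of_sum he hZ hc fun j hj => ?_
    rw [h.dPhi_eq hx, (H j hj k hk i hi).2]

lemma nijenhuis_dPhi_eq_zero_iff (h : S.IsAdaptedFrame e U) {x : M} (hx : x ∈ U) :
    (∀ X Y Z : VF M, SmoothAt X x → SmoothAt Y x → SmoothAt Z x →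
      S.nijenhuis X Y Z x = 0 ∧ S.dPhi X Y Z x = 0) ↔
      ∀ k i j, nijComp (connForm e x) k i j = 0 ∧ dPhiComp (connForm e x) k i j = 0 := by
  refine ⟨fun H k i j => ?_, fun H X Y Z hX hY hZ => ?_⟩
  · rw [← h.nijenhuis_eq hx, ← h.dPhi_eq hx]
    exact H _ _ _ (h.smoothAt hx k) (h.smoothAt hx i) (h.smoothAt hx j)
  · exact h.nijenhuis_dPhi_eq_zero hx (fun k _ i _ j _ => H k i j) hX.diffAt hY.diffAt hZ.diffAt
      (h.eq_sum hx (X x)) (h.eq_sum hx (Y x)) (h.eq_sum hx (Z x))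

lemma nijenhuis_dPhi_horizontal_eq_zero_iff (h : S.IsAdaptedFrame e U) {x : M} (hx : x ∈ U) :
    (∀ X Y Z : VF M, SmoothAt X x → SmoothAt Y x → SmoothAt Z x →
      S.eta X x = 0 → S.eta Y x = 0 → S.eta Z x = 0 →
      S.nijenhuis X Y Z x = 0 ∧ S.dPhi X Y Z x = 0) ↔
      ∀ k i j, k ≠ 4 → i ≠ 4 → j ≠ 4 →
        nijComp (connForm e x) k i j = 0 ∧ dPhiComp (connForm e x) k i j = 0 := by
  refine ⟨fun H k i j hk hi hj => ?_, fun H X Y Z hX hY hZ hX' hY' hZ' => ?_⟩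
  · have hη {a : Fin 5} (ha : a ≠ 4) : S.eta (e a) x = 0 := by
      rw [eta, ← h.xi x hx, h.inner_eq hx, if_neg ha.symm]
    rw [← h.nijenhuis_eq hx, ← h.dPhi_eq hx]
    exact H _ _ _ (h.smoothAt hx k) (h.smoothAt hx i) (h.smoothAt hx j) (hη hk) (hη hi) (hη hj)
  · exact h.nijenhuis_dPhi_eq_zero hx (fun k hk i hi j hj => H k i j (Finset.ne_of_mem_erase hk)
        (Finset.ne_of_mem_erase hi) (Finset.ne_of_mem_erase hj)) hX.diffAt hY.diffAt hZ.diffAt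
      (h.eq_sum_horizontal hx hX') (h.eq_sum_horizontal hx hY') (h.eq_sum_horizontal hx hZ')

end AlmostContact.IsAdaptedFrame

/-! ### Existence of adapted frames -/

/-- If `φ` is an almost contact structure on a Euclidean space and `ξ, a, φ a, b` are orthonormal,
then `(a, -φ a, b, -φ b, ξ)` is orthonormal, and `φ` has the standard matrix in this basis. -/
lemma adapted_vectors {E : Type*} [NormedAddCommGroup E] [InnerProductSpace ℝ E] (φ : E →ₗ[ℝ] E)
    {ξ a b : E} (hφξ : φ ξ = 0) (hφ : ∀ v, φ (φ v) = -v + (inner ℝ ξ v : ℝ) • ξ)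
    (hskew : ∀ v w, inner ℝ v (φ w) = -(inner ℝ (φ v) w : ℝ))
    (h1 : inner ℝ ξ ξ = (1 : ℝ)) (h2 : inner ℝ a a = (1 : ℝ)) (h3 : inner ℝ b b = (1 : ℝ))
    (ha : inner ℝ ξ a = (0 : ℝ)) (hb : inner ℝ ξ b = (0 : ℝ)) (hab : inner ℝ a b = (0 : ℝ))
    (hφab : inner ℝ (φ a) b = (0 : ℝ)) :
    (∀ i j, inner ℝ (![a, -φ a, b, -φ b, ξ] i) (![a, -φ a, b, -φ b, ξ] j)
        = if i = j then (1 : ℝ) else 0) ∧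
      ∀ i j, inner ℝ (![a, -φ a, b, -φ b, ξ] i) (φ (![a, -φ a, b, -φ b, ξ] j)) = Phi0 i j := by
  have hself (v : E) : inner ℝ (φ v) v = (0 : ℝ) := by
    have := hskew v v
    rw [real_inner_comm] at this
    linarith
  have hξφ (v : E) : inner ℝ ξ (φ v) = (0 : ℝ) := by rw [hskew, hφξ, inner_zero_left, neg_zero]
  have key : ∀ i j, inner ℝ (![a, -φ a, b, -φ b, ξ] i) (![a, -φ a, b, -φ b, ξ] j)
      = if i = j then (1 : ℝ) else 0 := by
    have ha' : inner ℝ a ξ = (0 : ℝ) := by rw [real_inner_comm, ha]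
    have hb' : inner ℝ b ξ = (0 : ℝ) := by rw [real_inner_comm, hb]
    have hba : inner ℝ b a = (0 : ℝ) := by rw [real_inner_comm, hab]
    have hφba : inner ℝ (φ b) a = (0 : ℝ) := by
      rw [real_inner_comm, hskew, hφab, neg_zero]
    have hφξ' (v : E) : inner ℝ (φ v) ξ = (0 : ℝ) := by rw [real_inner_comm, hξφ]
    intro i j
    fin_cases i <;> fin_cases j <;>
      simp [-inner_self_eq_norm_sq_to_K, hφ, h1, h2, h3, ha, hb, hab,
        ha', hb', hba, hself, hξφ, hφξ', hφba, hφab, hskew]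
  refine ⟨key, fun i j => ?_⟩
  have hj : φ (![a, -φ a, b, -φ b, ξ] j) = s j • ![a, -φ a, b, -φ b, ξ] (σ j) := by
    fin_cases j <;> simp [phiSign, phiIndex, hφξ, hφ, ha, hb]
  rw [hj, inner_smul_right, key]
  fin_cases i <;> fin_cases j <;> simp [phiSign, phiIndex, Phi0]

section Existence

variable {M : Type*} [TopologicalSpace M] [ChartedSpace E5 M] [IsManifold (𝓡 5) ∞ M]
  [RiemannianBundle (fun x : M => TangentSpace (𝓡 5) x)]

lemma exists_ne_zero_inner_eq_zero {x : M} {ι : Type*} [Fintype ι] (hι : Fintype.card ι < 5)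
    (f : ι → TangentSpace (𝓡 5) x) :
    ∃ v : TangentSpace (𝓡 5) x, v ≠ 0 ∧ ∀ i, inner ℝ (f i) v = (0 : ℝ) := by
  have hfin : Module.finrank ℝ (TangentSpace (𝓡 5) x) = 5 := finrank_euclideanSpace_fin
  have : FiniteDimensional ℝ (TangentSpace (𝓡 5) x) := .of_finrank_pos (by omega)
  have h1 := (Submodule.span ℝ (Set.range f)).finrank_add_finrank_orthogonal
  have h2 := finrank_range_le_card (R := ℝ) f
  rw [Set.finrank] at h2
  have h3 : 0 < Module.finrank ℝ (Submodule.span ℝ (Set.range f))ᗮ := by omega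
  obtain ⟨v, hv⟩ := Module.finrank_pos_iff_exists_ne_zero.1 h3
  refine ⟨v, by simpa using hv, fun i => ?_⟩
  exact v.2 _ (Submodule.subset_span ⟨i, rfl⟩)

variable [IsContMDiffRiemannianBundle (𝓡 5) ∞ E5 (fun x : M => TangentSpace (𝓡 5) x)]

/-- Gram–Schmidt: fewer than five orthonormal vector fields can be complemented, near each point, by
a unit vector field orthogonal to them. -/
lemma exists_unit_inner_eq_zero {ι : Type*} [Fintype ι] [DecidableEq ι] (hι : Fintype.card ι < 5)
    {f : ι → VF M} {U : Set M} (hU : IsOpen U) (hf : ∀ i, SmoothOn (f i) U)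
    (ho : ∀ y ∈ U, ∀ i j, inner ℝ (f i y) (f j y) = if i = j then (1 : ℝ) else 0)
    {x : M} (hx : x ∈ U) :
    ∃ (V : VF M) (U' : Set M), IsOpen U' ∧ U' ⊆ U ∧ x ∈ U' ∧ SmoothOn V U' ∧
      ∀ y ∈ U', inner ℝ (V y) (V y) = (1 : ℝ) ∧ ∀ i, inner ℝ (f i y) (V y) = (0 : ℝ) := by
  obtain ⟨v, hv, hv'⟩ := exists_ne_zero_inner_eq_zero hι fun i => f i x
  obtain ⟨t, ht, hts⟩ := FiberBundle.exists_contMDiffOn_extend (k := ∞) (𝓡 5) E5 v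
  set W : VF M := FiberBundle.extend E5 v with hW
  have hWx : W x = v := by simp [hW]
  obtain ⟨t', ht', ht'o, hxt'⟩ := mem_nhds_iff.1 ht
  set U₁ := U ∩ t'
  have hU₁ : IsOpen U₁ := hU.inter ht'o
  have hWs : SmoothOn W U₁ := hts.mono (Set.inter_subset_right.trans ht')
  have hfs (i : ι) : SmoothOn (f i) U₁ := (hf i).mono Set.inter_subset_left
  -- the component of `W` orthogonal to the given fields
  set P : VF M := fun y => W y - ∑ i, (inner ℝ (f i y) (W y) : ℝ) • f i y with hP
  have hPs : SmoothOn P U₁ :=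
    ContMDiffOn.sub_section hWs <| ContMDiffOn.sum_section fun i _ =>
      ContMDiffOn.smul_section ((hfs i).inner_bundle hWs) (hfs i)
  have hPx : P x = v := by simp [hP, hWx, hv']
  have hPo (y : M) (hy : y ∈ U) (i : ι) : inner ℝ (f i y) (P y) = (0 : ℝ) := by
    simp only [hP, inner_sub_right, inner_sum, inner_smul_right, ho y hy]
    simp
  have hgs : ContMDiffOn (𝓡 5) 𝓘(ℝ) ∞ (fun y => (inner ℝ (P y) (P y) : ℝ)) U₁ :=
    hPs.inner_bundle hPs
  set U' := U₁ ∩ (fun y => (inner ℝ (P y) (P y) : ℝ)) ⁻¹' {0}ᶜ with hU'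
  have hU'o : IsOpen U' := hgs.continuousOn.isOpen_inter_preimage hU₁ isOpen_compl_singleton
  have hr : ContMDiffOn (𝓡 5) 𝓘(ℝ) ∞ (fun y => (√(inner ℝ (P y) (P y)))⁻¹) U' := by
    intro y hy
    have hne : (inner ℝ (P y) (P y) : ℝ) ≠ 0 := hy.2
    have hpos : 0 < (inner ℝ (P y) (P y) : ℝ) := lt_of_le_of_ne real_inner_self_nonneg hne.symm
    have h1 : ContDiffAt ℝ ∞ (fun r : ℝ => (√r)⁻¹) (inner ℝ (P y) (P y)) :=
      (Real.contDiffAt_sqrt hne).inv (Real.sqrt_ne_zero'.2 hpos)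
    exact ContMDiffAt.comp_contMDiffWithinAt (g := fun r : ℝ => (√r)⁻¹)
      (f := fun y => (inner ℝ (P y) (P y) : ℝ)) y h1.contMDiffAt
      ((hgs y hy.1).mono Set.inter_subset_left)
  refine ⟨fun y => (√(inner ℝ (P y) (P y)))⁻¹ • P y, U', hU'o,
    Set.inter_subset_left.trans Set.inter_subset_left, ⟨⟨hx, hxt'⟩, ?_⟩,
    ContMDiffOn.smul_section hr (hPs.mono Set.inter_subset_left), fun y hy => ⟨?_, fun i => ?_⟩⟩
  · change (inner ℝ (P x) (P x) : ℝ) ≠ 0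
    rw [hPx]
    exact inner_self_ne_zero.2 hv
  · have hne : (inner ℝ (P y) (P y) : ℝ) ≠ 0 := hy.2
    rw [real_inner_smul_left, inner_smul_right, ← mul_assoc, ← mul_inv,
      Real.mul_self_sqrt real_inner_self_nonneg, inv_mul_cancel₀ hne]
  · rw [inner_smul_right, hPo y hy.1.1, mul_zero]

namespace AlmostContact

variable (S : AlmostContact M)

/-- Every point has an adapted frame: choose a unit field `e_0 ⟂ ξ`, put `e_1 = -φ e_0`, choose a
unit field `e_2 ⟂ ξ, e_0, e_1`, and put `e_3 = -φ e_2`. -/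
theorem exists_isAdaptedFrame (x : M) :
    ∃ (e : Fin 5 → VF M) (U : Set M), S.IsAdaptedFrame e U ∧ x ∈ U := by
  obtain ⟨A, U₁, hU₁, -, hx₁, hAs, hA⟩ :=
    exists_unit_inner_eq_zero (ι := Fin 1) (by simp) (f := fun _ => S.ξ) (x := x) isOpen_univ
      (fun _ => S.smooth_ξ.contMDiffOn)
      (fun y _ i j => by rw [S.norm_ξ, if_pos (Subsingleton.elim i j)]) (Set.mem_univ x)
  have hAξ (y : M) (hy : y ∈ U₁) : inner ℝ (S.ξ y) (A y) = (0 : ℝ) := (hA y hy).2 0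
  have hφA (y : M) (hy : y ∈ U₁) : inner ℝ (S.φ y (A y)) (S.φ y (A y)) = (1 : ℝ) := by
    rw [S.inner_φ, (hA y hy).1, hAξ y hy, mul_zero, sub_zero]
  have hAφA (y : M) : inner ℝ (A y) (S.φ y (A y)) = (0 : ℝ) := by
    have := S.inner_φ_right y (A y) (A y)
    rw [real_inner_comm (A y)] at this
    linarith [real_inner_comm (A y) (S.φ y (A y))]
  obtain ⟨B, U₂, hU₂, hU₂₁, hx₂, hBs, hB⟩ :=
    exists_unit_inner_eq_zero (ι := Fin 3) (by simp) (f := ![S.ξ, A, S.ap A]) (x := x) hU₁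
      (fun i => by
        fin_cases i
        · exact S.smooth_ξ.contMDiffOn
        · exact hAs
        · exact S.smoothOn_ap hAs)
      (fun y hy i j => by
        fin_cases i <;> fin_cases j
        · exact S.norm_ξ y
        · exact hAξ y hy
        · exact S.inner_ξ_φ y (A y)
        · exact (real_inner_comm _ _).trans (hAξ y hy)
        · exact (hA y hy).1
        · exact hAφA y
        · exact (real_inner_comm _ _).trans (S.inner_ξ_φ y (A y))
        · exact (real_inner_comm _ _).trans (hAφA y)
        · exact hφA y hy)
      hx₁
  have hneg {V : VF M} (hV : SmoothOn V U₂) : SmoothOn (-V) U₂ := ContMDiffOn.neg_section hV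
  have key (y : M) (hy : y ∈ U₂) :=
    adapted_vectors (S.φ y : TangentSpace (𝓡 5) y →ₗ[ℝ] TangentSpace (𝓡 5) y) (S.φ_ξ y) (S.φ_sq y)
      (S.inner_φ_right y) (S.norm_ξ y) (hA y (hU₂₁ hy)).1 (hB y hy).1
      (hAξ y (hU₂₁ hy)) ((hB y hy).2 0) ((hB y hy).2 1) ((hB y hy).2 2)
  have he (i : Fin 5) (y : M) : (![A, -S.ap A, B, -S.ap B, S.ξ] : Fin 5 → VF M) i y
      = ![A y, -S.φ y (A y), B y, -S.φ y (B y), S.ξ y] i := by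
    fin_cases i <;> rfl
  refine ⟨![A, -S.ap A, B, -S.ap B, S.ξ], U₂, ⟨hU₂, fun i => ?_, fun y hy => ?_, fun y hy i j => ?_,
    fun y _ => rfl⟩, hx₂⟩
  · fin_cases i
    · exact hAs.mono hU₂₁
    · exact hneg ((S.smoothOn_ap hAs).mono hU₂₁)
    · exact hBs
    · exact hneg (S.smoothOn_ap hBs)
    · exact S.smooth_ξ.contMDiffOn
  · rw [orthonormal_iff_ite]
    intro i j
    rw [he, he]
    exact (key y hy).1 i j
  · change inner ℝ _ (S.φ y _) = _
    rw [he, he]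
    exact (key y hy).2 i j

end AlmostContact
end Existence

end ACM

end

theorem proposition5 {M : Type*} [TopologicalSpace M] [ChartedSpace ACM.E5 M]
    [IsManifold (𝓡 5) ∞ M] [RiemannianBundle (fun x : M => TangentSpace (𝓡 5) x)]
    [IsContMDiffRiemannianBundle (𝓡 5) ∞ ACM.E5 (fun x : M => TangentSpace (𝓡 5) x)]
    (S : ACM.AlmostContact M) :
    (S.IsGenQuasiSasaki ↔ S.IsOfClass (ACM.W3 ⊔ ACM.W4 ⊔ ACM.W5 ⊔ ACM.W7)) ∧
      (S.IsQuasiSasaki ↔ S.IsOfClass (ACM.W3 ⊔ ACM.W5)) := by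
  constructor
  · have hpt (x : M) (e : Fin 5 → ACM.VF M) (U : Set M) (h : S.IsAdaptedFrame e U) (hx : x ∈ U) :=
      ((and_congr (h.nijenhuis_dPhi_horizontal_eq_zero_iff hx) (h.lieMetric_eq_zero_iff hx)).trans
        (ACM.nij_dPhi_killing_iff (h.connForm_mem_so5 hx))).trans
        (ACM.prW_mem_sup_iff (h.connForm_mem_so5 hx)).symm
    constructor
    · rintro ⟨h1, h2⟩ x
      exact ⟨S.exists_isAdaptedFrame x, fun e U h hx => (hpt x e U h hx).1 ⟨h1 x, h2 x⟩⟩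
    · intro H
      refine ⟨fun x => ?_, fun x => ?_⟩ <;> obtain ⟨⟨e, U, h, hx⟩, hW⟩ := H x
      · exact ((hpt x e U h hx).2 (hW e U h hx)).1
      · exact ((hpt x e U h hx).2 (hW e U h hx)).2
  · have hpt (x : M) (e : Fin 5 → ACM.VF M) (U : Set M) (h : S.IsAdaptedFrame e U) (hx : x ∈ U) :=
      ((h.nijenhuis_dPhi_eq_zero_iff hx).trans
        (ACM.nij_dPhi_iff (h.connForm_mem_so5 hx))).trans
        (ACM.prW_mem_W3_sup_W5_iff (h.connForm_mem_so5 hx)).symm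
    constructor
    · intro H x
      exact ⟨S.exists_isAdaptedFrame x, fun e U h hx => (hpt x e U h hx).1 (H x)⟩
    · intro H x
      obtain ⟨⟨e, U, h, hx⟩, hW⟩ := H x
      exact (hpt x e U h hx).2 (hW e U h hx)
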